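/- Let $k \ge 4$ and $2 \le s \le k+1$ be integers, and let $r_{k,s}(m)$ denote the number of $s$-tuples $(x_1,\dots,x_s)$ of positive integers with $x_1^k+\cdots+x_s^k=m$. Then, for all real $x \ge 1$, $$\sum_{1\le m\le x} r_{k,s}(m) = \frac{\Gamma\big(\frac{k+1}{k}\big)^s}{\Gamma\big(\frac{k+s}{k}\big)}\, x^{\frac{s}{k}} - \frac{s}{2}\cdot\frac{\Gamma\big(\frac{k+1}{k}\big)^{s-1}}{\Gamma\big(\frac{k+s-1}{k}\big)}\, x^{\frac{s-1}{k}} + O\Big(x^{\frac{(s-1)k-1}{k^2}}\Big),$$ where the implied constant depends only on $k$ and $s$. In particular, the same formula holds with $x$ replaced by any integer $n\ge 1$. -/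

import Mathlib

/-- `powerRep k s m` is the number `r_{k,s}(m)` of ordered representations of `m` as a sum of
`s` positive `k`-th powers: the number of tuples `(x₁, …, x_s)` of positive integers with
`x₁ ^ k + ⋯ + x_s ^ k = m`. -/
noncomputable def powerRep (k s m : ℕ) : ℕ :=
  Set.ncard {x : Fin s → ℕ | (∀ i, 0 < x i) ∧ ∑ i, x i ^ k = m}

/-- For `k ≠ 0` the set of representations is finite, so that `powerRep` really counts it. -/
theorem powerRep_finite {k : ℕ} (hk : k ≠ 0) (s m : ℕ) :
    {x : Fin s → ℕ | (∀ i, 0 < x i) ∧ ∑ i, x i ^ k = m}.Finite := by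
  refine (Set.Finite.pi' (fun _ : Fin s => Set.finite_Iic m)).subset ?_
  rintro x ⟨_, hx⟩ i
  calc x i ≤ x i ^ k := Nat.le_self_pow hk _
    _ ≤ ∑ j, x j ^ k :=
        Finset.single_le_sum (f := fun j => x j ^ k) (fun _ _ => Nat.zero_le _) (Finset.mem_univ i)
    _ = m := hx

/-- The two main terms
`Γ((k+1)/k)^s / Γ((k+s)/k) · x^(s/k) - (s/2) · Γ((k+1)/k)^(s-1) / Γ((k+s-1)/k) · x^((s-1)/k)`. -/
noncomputable def powerRepMain (k s : ℕ) (x : ℝ) : ℝ :=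
  Real.Gamma (((k : ℝ) + 1) / k) ^ s / Real.Gamma (((k : ℝ) + s) / k) * x ^ ((s : ℝ) / k)
    - (s : ℝ) / 2 *
      (Real.Gamma (((k : ℝ) + 1) / k) ^ (s - 1) / Real.Gamma (((k : ℝ) + s - 1) / k)) *
      x ^ (((s : ℝ) - 1) / k)

/-! Put x = R^k. Fixing one variable n ≤ R of a representation leaves s - 1 variables with bound R^k
- n^k, so everything rests on s = 2 and on an induction that sums over one more variable.

For s = 2 the count is the sum of ⌊R F(n/R)⌋ over n ≤ R, where F(u) = (1 - u^k)^(1/k). Writing ⌊t⌋ =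
t - 1/2 - (sawtooth of t) separates a smooth sum from a sawtooth sum along the superellipse. The
sawtooth is half the derivative of the periodic second Bernoulli function, whose Fourier series
converges absolutely. A difference quotient with step R^(-1/4) therefore reduces the sawtooth sum to
exponential sums, bounded by Kusmin–Landau and van der Corput's second derivative test
(`abs_sum_sawtooth_dilate_le`).

The curvature of F vanishes to order k - 2 at 0 and is unbounded at 1, so the arc is cut dyadically
towards both ends. Near 1 the pieces sum to O(R^(1-1/k)). At scale τ near 0 the flatness costs
R^(1/2) τ^(-(k-2)/2); stopping at τ ≍ R^(-1/k), below which only O(R^(1-1/k)) terms remain, gives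
R^(1-1/k). The generic error R^(3/4) is no larger, since k ≥ 4.

In the induction the error gains a factor R from the at most R values of n. The main terms are
summed by Euler–Maclaurin for the function (R^k - y^k)^(s/k), concave because s ≤ k, and by Beta
integrals, which give the Gamma quotients (`exists_abs_sum_powerRepMain_sub_le`). -/

/-! ### The Kusmin–Landau inequality -/

/-- The additive character `t ↦ exp (2 π i t)`. -/
noncomputable def expTwoPiI (t : ℝ) : ℂ := Complex.exp ((2 * Real.pi * t : ℝ) * Complex.I)

theorem norm_expTwoPiI (t : ℝ) : ‖expTwoPiI t‖ = 1 := Complex.norm_exp_ofReal_mul_I _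

theorem expTwoPiI_add (s t : ℝ) : expTwoPiI (s + t) = expTwoPiI s * expTwoPiI t := by
  rw [expTwoPiI, expTwoPiI, expTwoPiI, ← Complex.exp_add]
  congr 1
  push_cast
  ring

theorem expTwoPiI_re (t : ℝ) : (expTwoPiI t).re = Real.cos (2 * Real.pi * t) :=
  Complex.exp_ofReal_mul_I_re _

theorem expTwoPiI_add_intCast (t : ℝ) (m : ℤ) : expTwoPiI (t + m) = expTwoPiI t := by
  rw [expTwoPiI_add]
  have : expTwoPiI m = 1 := by
    rw [expTwoPiI, Complex.exp_eq_one_iff]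
    exact ⟨m, by push_cast; ring⟩
  rw [this, mul_one]

/-- The value `1 / (1 - exp (2 π i t))`, written with the cotangent. -/
noncomputable def cotWeight (t : ℝ) : ℂ :=
  1 / 2 + (Real.cos (Real.pi * t) / Real.sin (Real.pi * t) / 2 : ℝ) * Complex.I

theorem cotWeight_mul {t : ℝ} (h : Real.sin (Real.pi * t) ≠ 0) :
    cotWeight t * (1 - expTwoPiI t) = 1 := by
  have h1 : expTwoPiI t = (Real.cos (Real.pi * t) + Real.sin (Real.pi * t) * Complex.I) ^ 2 := by
    rw [expTwoPiI, Complex.ofReal_cos, Complex.ofReal_sin, ← Complex.exp_mul_I, ← Complex.exp_nat_mul]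
    congr 1
    push_cast
    ring
  have h2 : (Real.sin (Real.pi * t) : ℂ) ≠ 0 := by exact_mod_cast h
  have h3 : (Real.cos (Real.pi * t) : ℂ) ^ 2 = 1 - (Real.sin (Real.pi * t) : ℂ) ^ 2 := by
    rw [eq_sub_iff_add_eq]
    exact_mod_cast Real.cos_sq_add_sin_sq _
  rw [h1, cotWeight]
  push_cast at h2 h3 ⊢
  set c := Complex.cos (Real.pi * t)
  set s := Complex.sin (Real.pi * t)
  field_simp
  have hI : Complex.I ^ 2 = -1 := Complex.I_sq
  have hI3 : Complex.I ^ 3 = -Complex.I := Complex.I_pow_three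
  ring_nf
  have h4 : c ^ 3 = c * (1 - s ^ 2) := by rw [← h3]; ring
  simp only [hI, hI3, h3, h4]
  ring_nf

theorem two_mul_le_sin_pi_mul {θ t : ℝ} (hθ : 0 ≤ θ) (h1 : θ ≤ t) (h2 : t ≤ 1 - θ) :
    2 * θ ≤ Real.sin (Real.pi * t) := by
  have key : ∀ u : ℝ, θ ≤ u → u ≤ 1 / 2 → 2 * θ ≤ Real.sin (Real.pi * u) := by
    intro u hu hu2
    have := Real.mul_le_sin (x := Real.pi * u) (by have := Real.pi_pos; have : 0 ≤ u := by linarith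
                                                   positivity) (by nlinarith [Real.pi_pos])
    have h3 : 2 / Real.pi * (Real.pi * u) = 2 * u := by field_simp
    linarith
  rcases le_total t (1 / 2) with h | h
  · exact key t h1 h
  · have := key (1 - t) (by linarith) (by linarith)
    rwa [mul_sub, mul_one, Real.sin_pi_sub] at this

theorem norm_cotWeight_le {θ t : ℝ} (hθ : 0 < θ) (h1 : θ ≤ t) (h2 : t ≤ 1 - θ) :
    ‖cotWeight t‖ ≤ 1 / (4 * θ) := by
  have hs := two_mul_le_sin_pi_mul hθ.le h1 h2
  have hs0 : 0 < Real.sin (Real.pi * t) := by linarith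
  have h3 := Real.cos_sq_add_sin_sq (Real.pi * t)
  have h4 : ‖cotWeight t‖ = 1 / (2 * Real.sin (Real.pi * t)) := by
    have : Complex.normSq (cotWeight t) = (1 / (2 * Real.sin (Real.pi * t))) ^ 2 := by
      have h5 : cotWeight t = ((1 / 2 : ℝ) : ℂ) +
          (Real.cos (Real.pi * t) / Real.sin (Real.pi * t) / 2 : ℝ) * Complex.I := by
        rw [cotWeight]
        push_cast
        rfl
      rw [h5, Complex.normSq_add_mul_I]
      field_simp
      linarith
    rw [Complex.norm_def, this, Real.sqrt_sq (by positivity)]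
  rw [h4]
  apply one_div_le_one_div_of_le <;> linarith

/-- All weights lie on the line Re = 1/2 and the cotangent decreases on (0, π). The distance is thus
a signed difference, which telescopes along a monotone sequence. -/
theorem norm_cotWeight_sub {s t : ℝ} (h1 : 0 < s) (h2 : s ≤ t) (h3 : t < 1) :
    ‖cotWeight t - cotWeight s‖ =
      (Real.cos (Real.pi * s) / Real.sin (Real.pi * s) -
        Real.cos (Real.pi * t) / Real.sin (Real.pi * t)) / 2 := by
  have hp := Real.pi_pos
  have hs : 0 < Real.sin (Real.pi * s) := Real.sin_pos_of_pos_of_lt_pi (by positivity) (by nlinarith)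
  have ht : 0 < Real.sin (Real.pi * t) :=
    Real.sin_pos_of_pos_of_lt_pi (mul_pos hp (by linarith)) (by nlinarith)
  have hd : 0 ≤ Real.sin (Real.pi * t - Real.pi * s) :=
    Real.sin_nonneg_of_nonneg_of_le_pi (by nlinarith) (by nlinarith)
  have : cotWeight t - cotWeight s = ((Real.cos (Real.pi * t) / Real.sin (Real.pi * t) -
        Real.cos (Real.pi * s) / Real.sin (Real.pi * s)) / 2 : ℝ) * Complex.I := by
    rw [cotWeight, cotWeight]
    push_cast
    ring
  rw [this, norm_mul, Complex.norm_I, mul_one, Complex.norm_real, Real.norm_eq_abs, abs_of_nonpos]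
  · ring
  · rw [Real.sin_sub] at hd
    have : Real.cos (Real.pi * t) / Real.sin (Real.pi * t) ≤
        Real.cos (Real.pi * s) / Real.sin (Real.pi * s) := by
      rw [div_le_div_iff₀ ht hs]
      linarith
    linarith

theorem abs_cot_le {θ t : ℝ} (hθ : 0 < θ) (h1 : θ ≤ t) (h2 : t ≤ 1 - θ) :
    |Real.cos (Real.pi * t) / Real.sin (Real.pi * t)| ≤ 1 / (2 * θ) := by
  have hs := two_mul_le_sin_pi_mul hθ.le h1 h2
  rw [abs_div, abs_of_pos (a := Real.sin _) (by linarith)]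
  exact div_le_div₀ zero_le_one (Real.abs_cos_le_one _) (by linarith) hs

/-- The Kusmin–Landau inequality for increasing differences between `θ` and `1 - θ`. -/
theorem norm_sum_expTwoPiI_le_of_mem_Icc {f : ℕ → ℝ} {p q : ℕ} {θ : ℝ} (hθ : 0 < θ)
    (hmono : ∀ n, p ≤ n → n + 1 < q → f (n + 1) - f n ≤ f (n + 2) - f (n + 1))
    (hlo : ∀ n, p ≤ n → n < q → θ ≤ f (n + 1) - f n)
    (hhi : ∀ n, p ≤ n → n < q → f (n + 1) - f n ≤ 1 - θ) :
    ‖∑ n ∈ Finset.Ico p q, expTwoPiI (f n)‖ ≤ 1 / θ := by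
  rcases le_or_gt q p with hqp | hpq
  · rw [Finset.Ico_eq_empty_of_le hqp]
    simp only [Finset.sum_empty, norm_zero]
    positivity
  -- With w the weight of the n-th difference, e(f n) = w e(f n) - w e(f (n + 1)), which prepares
  -- summation by parts.
  have hE : ∀ n, p ≤ n → n < q → cotWeight (f (n + 1) - f n) * expTwoPiI (f (n + 1)) =
      cotWeight (f (n + 1) - f n) * expTwoPiI (f n) - expTwoPiI (f n) := by
    intro n h1 h2
    have hs := two_mul_le_sin_pi_mul hθ.le (hlo n h1 h2) (hhi n h1 h2)
    have h3 := cotWeight_mul (t := f (n + 1) - f n) (by linarith)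
    have h4 : expTwoPiI (f (n + 1)) = expTwoPiI (f n) * expTwoPiI (f (n + 1) - f n) := by
      rw [← expTwoPiI_add]
      congr 1
      ring
    rw [h4]
    linear_combination (-expTwoPiI (f n)) * h3
  -- Summation by parts: the first weight is bounded by 1/(4θ), and the variation of the later ones
  -- telescopes in the cotangent.
  have key : ∀ r, p ≤ r → r < q →
      ‖∑ n ∈ Finset.Ico p (r + 1), expTwoPiI (f n) +
        cotWeight (f (r + 1) - f r) * expTwoPiI (f (r + 1))‖ ≤ 1 / (4 * θ) +
        (Real.cos (Real.pi * (f (p + 1) - f p)) / Real.sin (Real.pi * (f (p + 1) - f p)) -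
        Real.cos (Real.pi * (f (r + 1) - f r)) / Real.sin (Real.pi * (f (r + 1) - f r))) / 2 := by
    intro r hr
    induction r, hr using Nat.le_induction with
    | base =>
      intro h
      rw [hE p le_rfl h]
      simp only [Nat.Ico_succ_singleton, Finset.sum_singleton, sub_self, zero_div, add_zero]
      rw [add_sub_cancel, norm_mul, norm_expTwoPiI, mul_one]
      exact norm_cotWeight_le hθ (hlo p le_rfl h) (hhi p le_rfl h)
    | succ r hr ih =>
      intro h
      have ih' := ih (by omega)
      rw [Finset.sum_Ico_succ_top (by omega), hE (r + 1) (by omega) h]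
      have h5 : ∑ n ∈ Finset.Ico p (r + 1), expTwoPiI (f n) + expTwoPiI (f (r + 1)) +
          (cotWeight (f (r + 1 + 1) - f (r + 1)) * expTwoPiI (f (r + 1)) - expTwoPiI (f (r + 1))) =
          (∑ n ∈ Finset.Ico p (r + 1), expTwoPiI (f n) +
            cotWeight (f (r + 1) - f r) * expTwoPiI (f (r + 1))) +
          (cotWeight (f (r + 1 + 1) - f (r + 1)) - cotWeight (f (r + 1) - f r)) *
            expTwoPiI (f (r + 1)) := by ring
      rw [h5]
      refine (norm_add_le _ _).trans ?_
      rw [norm_mul, norm_expTwoPiI, mul_one, norm_cotWeight_sub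
        (lt_of_lt_of_le hθ (hlo r hr (by omega))) (hmono r hr h)
        (lt_of_le_of_lt (hhi (r + 1) (by omega) h) (by linarith))]
      linarith
  obtain ⟨r, rfl⟩ : ∃ r, q = r + 1 := ⟨q - 1, by omega⟩
  have hr : p ≤ r := by omega
  have h1 := key r hr (by omega)
  have h2 := norm_cotWeight_le hθ (hlo r hr (by omega)) (hhi r hr (by omega))
  have h3 := abs_le.1 (abs_cot_le hθ (hlo r hr (by omega)) (hhi r hr (by omega)))
  have h4 := abs_le.1 (abs_cot_le hθ (hlo p le_rfl (by omega)) (hhi p le_rfl (by omega)))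
  have h5 := norm_sub_le (∑ n ∈ Finset.Ico p (r + 1), expTwoPiI (f n) +
        cotWeight (f (r + 1) - f r) * expTwoPiI (f (r + 1)))
        (cotWeight (f (r + 1) - f r) * expTwoPiI (f (r + 1)))
  rw [add_sub_cancel_right, norm_mul, norm_expTwoPiI, mul_one] at h5
  -- The two end weights plus the total variation of the weights.
  have h6 : 1 / θ = 1 / (4 * θ) + 1 / (4 * θ) + (1 / (2 * θ) + 1 / (2 * θ)) / 2 := by
    field_simp
    norm_num
  rw [h6]
  linarith [h3.1, h4.2]

/-- The Kusmin–Landau inequality. -/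
theorem norm_sum_expTwoPiI_le {f : ℕ → ℝ} {p q : ℕ} {θ : ℝ} (m : ℤ) (hθ : 0 < θ)
    (hmono : ∀ n, p ≤ n → n + 1 < q → f (n + 1) - f n ≤ f (n + 2) - f (n + 1))
    (hlo : ∀ n, p ≤ n → n < q → m + θ ≤ f (n + 1) - f n)
    (hhi : ∀ n, p ≤ n → n < q → f (n + 1) - f n ≤ m + 1 - θ) :
    ‖∑ n ∈ Finset.Ico p q, expTwoPiI (f n)‖ ≤ 1 / θ := by
  have h := norm_sum_expTwoPiI_le_of_mem_Icc (f := fun n => f n - m * n) (p := p) (q := q) hθ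
    (fun n h1 h2 => by have := hmono n h1 h2; push_cast; linarith)
    (fun n h1 h2 => by have := hlo n h1 h2; push_cast; linarith)
    (fun n h1 h2 => by have := hhi n h1 h2; push_cast; linarith)
  convert h using 3 with n
  have := expTwoPiI_add_intCast (f n - m * n) (m * n)
  rw [← this]
  congr 1
  push_cast
  ring

/-! ### Van der Corput's second derivative test -/

section SecondDifference

variable {g : ℕ → ℝ} {a b : ℕ} {l : ℝ}

theorem mul_sub_le_of_forall_add_le (hg : ∀ n, a ≤ n → n + 1 < b → g n + l ≤ g (n + 1))
    {i j : ℕ} (hi : a ≤ i) (hij : i ≤ j) (hj : j < b) : l * ((j : ℝ) - i) ≤ g j - g i := by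
  induction j, hij using Nat.le_induction with
  | base => simp
  | succ j hij ih =>
    have h1 := ih (by omega)
    have h2 := hg j (by omega) hj
    push_cast
    linarith

/-- Consecutive values of `g` are at least `l` apart, so an interval of length `θ` holds at most `θ
/ l + 1` of them. -/
theorem card_le_of_forall_add_le (hl : 0 < l)
    (hg : ∀ n, a ≤ n → n + 1 < b → g n + l ≤ g (n + 1)) {c θ : ℝ} (hθ : 0 ≤ θ) {S : Finset ℕ}
    (hS : S ⊆ Finset.Ico a b) (h1 : ∀ n ∈ S, c ≤ g n) (h2 : ∀ n ∈ S, g n ≤ c + θ) :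
    (S.card : ℝ) ≤ θ / l + 1 := by
  rcases S.eq_empty_or_nonempty with rfl | hne
  · simp only [Finset.card_empty, Nat.cast_zero]
    positivity
  have hm := Finset.min'_mem S hne
  have hM := Finset.max'_mem S hne
  have hle : S.min' hne ≤ S.max' hne := Finset.min'_le_max' S hne
  have hcard : S.card ≤ S.max' hne + 1 - S.min' hne := by
    rw [← Nat.card_Icc]
    exact Finset.card_le_card fun n hn =>
      Finset.mem_Icc.2 ⟨Finset.min'_le S n hn, Finset.le_max' S n hn⟩
  have h3 := mul_sub_le_of_forall_add_le hg (Finset.mem_Ico.1 (hS hm)).1 hle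
    (Finset.mem_Ico.1 (hS hM)).2
  have h4 := h1 _ hm
  have h5 := h2 _ hM
  have h6 : (S.card : ℝ) ≤ (S.max' hne : ℝ) + 1 - S.min' hne := by
    have : S.card + S.min' hne ≤ S.max' hne + 1 := by omega
    have : (S.card : ℝ) + S.min' hne ≤ S.max' hne + 1 := by exact_mod_cast this
    linarith
  have h7 : (S.max' hne : ℝ) - S.min' hne ≤ θ / l := by
    rw [le_div_iff₀ hl]
    linarith
  linarith

theorem exists_eq_Ico_of_forall_mem {S : Finset ℕ}
    (hS : ∀ i ∈ S, ∀ j ∈ S, ∀ n, i ≤ n → n ≤ j → n ∈ S) : ∃ p q, S = Finset.Ico p q := by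
  rcases S.eq_empty_or_nonempty with rfl | hne
  · exact ⟨0, 0, by simp⟩
  refine ⟨S.min' hne, S.max' hne + 1, ?_⟩
  ext n
  rw [Finset.mem_Ico]
  constructor
  · intro h
    exact ⟨Finset.min'_le S n h, Nat.lt_succ_of_le (Finset.le_max' S n h)⟩
  · rintro ⟨h1, h2⟩
    exact hS _ (Finset.min'_mem S hne) _ (Finset.max'_mem S hne) n h1 (by omega)

end SecondDifference

theorem norm_sum_expTwoPiI_le_card (f : ℕ → ℝ) (S : Finset ℕ) :
    ‖∑ n ∈ S, expTwoPiI (f n)‖ ≤ S.card := by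
  refine (norm_sum_le _ _).trans ?_
  simp [norm_expTwoPiI]

/-- The contribution to the exponential sum of the `n` whose difference lies in `[m, m + 1)`. -/
theorem norm_sum_fiber_expTwoPiI_le {f : ℕ → ℝ} {a b : ℕ} {l θ : ℝ} (hl : 0 < l) (hθ : 0 < θ)
    (hg : ∀ n, a ≤ n → n + 1 < b → f (n + 1) - f n + l ≤ f (n + 2) - f (n + 1)) (m : ℤ) :
    ‖∑ n ∈ (Finset.Ico a b).filter (fun n => ⌊f (n + 1) - f n⌋ = m), expTwoPiI (f n)‖ ≤
      2 * (θ / l + 1) + 1 / θ := by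
  set F := (Finset.Ico a b).filter (fun n => ⌊f (n + 1) - f n⌋ = m) with hF
  have hFm : ∀ n ∈ F, (m : ℝ) ≤ f (n + 1) - f n ∧ f (n + 1) - f n < m + 1 := by
    intro n hn
    exact Int.floor_eq_iff.1 (Finset.mem_filter.1 hn).2
  have hFs : F ⊆ Finset.Ico a b := Finset.filter_subset _ _
  -- The fibre splits into differences within `θ` of `m`, those within `θ` of `m + 1`, and the
  -- middle. The two edges are counted trivially; the middle is a block of consecutive integers,
  -- where Kusmin–Landau applies.
  rw [← Finset.sum_filter_add_sum_filter_not F (fun n => f (n + 1) - f n < m + θ),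
    ← Finset.sum_filter_add_sum_filter_not (F.filter (fun n => ¬ f (n + 1) - f n < m + θ))
      (fun n => m + 1 - θ < f (n + 1) - f n)]
  have hg' : ∀ n, a ≤ n → n + 1 < b →
      (fun n => f (n + 1) - f n) n + l ≤ (fun n => f (n + 1) - f n) (n + 1) := hg
  have hA : ‖∑ n ∈ F.filter (fun n => f (n + 1) - f n < m + θ), expTwoPiI (f n)‖ ≤ θ / l + 1 := by
    refine (norm_sum_expTwoPiI_le_card _ _).trans (card_le_of_forall_add_le hl hg' (c := m) hθ.le
      ((Finset.filter_subset _ _).trans hFs) ?_ ?_)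
    · intro n hn
      exact (hFm n (Finset.mem_filter.1 hn).1).1
    · intro n hn
      exact (Finset.mem_filter.1 hn).2.le
  have hB : ‖∑ n ∈ (F.filter (fun n => ¬ f (n + 1) - f n < m + θ)).filter
      (fun n => m + 1 - θ < f (n + 1) - f n), expTwoPiI (f n)‖ ≤ θ / l + 1 := by
    refine (norm_sum_expTwoPiI_le_card _ _).trans (card_le_of_forall_add_le hl hg' (c := m + 1 - θ)
      hθ.le ((Finset.filter_subset _ _).trans ((Finset.filter_subset _ _).trans hFs)) ?_ ?_)
    · intro n hn
      exact (Finset.mem_filter.1 hn).2.le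
    · intro n hn
      have := (hFm n (Finset.mem_filter.1 (Finset.mem_filter.1 hn).1).1).2
      linarith
  have hC : ‖∑ n ∈ (F.filter (fun n => ¬ f (n + 1) - f n < m + θ)).filter
      (fun n => ¬ m + 1 - θ < f (n + 1) - f n), expTwoPiI (f n)‖ ≤ 1 / θ := by
    set S := (F.filter (fun n => ¬ f (n + 1) - f n < m + θ)).filter
      (fun n => ¬ m + 1 - θ < f (n + 1) - f n) with hS
    have hmem : ∀ n, n ∈ S ↔ (a ≤ n ∧ n < b) ∧ ⌊f (n + 1) - f n⌋ = m ∧ m + θ ≤ f (n + 1) - f n ∧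
        f (n + 1) - f n ≤ m + 1 - θ := by
      intro n
      simp only [hS, hF, Finset.mem_filter, Finset.mem_Ico, not_lt, and_assoc]
    obtain ⟨p, q, hpq⟩ : ∃ p q, S = Finset.Ico p q := by
      apply exists_eq_Ico_of_forall_mem
      intro i hi j hj n hin hnj
      rw [hmem] at hi hj ⊢
      have h1 := mul_sub_le_of_forall_add_le hg' hi.1.1 hin (by omega)
      have h2 := mul_sub_le_of_forall_add_le hg' (by omega) hnj hj.1.2
      have h3 : 0 ≤ l * ((n : ℝ) - i) := mul_nonneg hl.le (sub_nonneg.2 (by exact_mod_cast hin))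
      have h4 : 0 ≤ l * ((j : ℝ) - n) := mul_nonneg hl.le (sub_nonneg.2 (by exact_mod_cast hnj))
      refine ⟨by omega, ?_, by linarith [hi.2.2.1], by linarith [hj.2.2.2]⟩
      rw [Int.floor_eq_iff]
      constructor <;> linarith [hi.2.2.1, hj.2.2.2]
    have hmem' : ∀ n, p ≤ n → n < q → (a ≤ n ∧ n < b) ∧ ⌊f (n + 1) - f n⌋ = m ∧
        m + θ ≤ f (n + 1) - f n ∧ f (n + 1) - f n ≤ m + 1 - θ := by
      intro n h1 h2
      rw [← hmem, hpq, Finset.mem_Ico]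
      exact ⟨h1, h2⟩
    rw [hpq]
    refine norm_sum_expTwoPiI_le m hθ ?_ (fun n h1 h2 => (hmem' n h1 h2).2.2.1)
      (fun n h1 h2 => (hmem' n h1 h2).2.2.2)
    intro n h1 h2
    have h3 := hmem' n h1 (by omega)
    have h4 := hmem' (n + 1) (by omega) h2
    have := hg n h3.1.1 h4.1.2
    linarith
  have h1 := norm_add_le (∑ n ∈ F.filter (fun n => f (n + 1) - f n < m + θ), expTwoPiI (f n))
    (∑ n ∈ (F.filter (fun n => ¬ f (n + 1) - f n < m + θ)).filter
      (fun n => m + 1 - θ < f (n + 1) - f n), expTwoPiI (f n) +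
    ∑ n ∈ (F.filter (fun n => ¬ f (n + 1) - f n < m + θ)).filter
      (fun n => ¬ m + 1 - θ < f (n + 1) - f n), expTwoPiI (f n))
  have h2 := norm_add_le (∑ n ∈ (F.filter (fun n => ¬ f (n + 1) - f n < m + θ)).filter
      (fun n => m + 1 - θ < f (n + 1) - f n), expTwoPiI (f n))
    (∑ n ∈ (F.filter (fun n => ¬ f (n + 1) - f n < m + θ)).filter
      (fun n => ¬ m + 1 - θ < f (n + 1) - f n), expTwoPiI (f n))
  linarith

/-- Van der Corput's second derivative test, with differences in place of derivatives. -/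
theorem norm_sum_expTwoPiI_le_of_second_difference {f : ℕ → ℝ} {a b : ℕ} {l A V : ℝ} (hl : 0 < l)
    (hab : a + 2 ≤ b)
    (hg : ∀ n, a ≤ n → n + 1 < b → f (n + 1) - f n + l ≤ f (n + 2) - f (n + 1))
    (hlo : ∀ n, a ≤ n → n < b → A ≤ f (n + 1) - f n)
    (hhi : ∀ n, a ≤ n → n < b → f (n + 1) - f n ≤ A + V) :
    ‖∑ n ∈ Finset.Ico a b, expTwoPiI (f n)‖ ≤ 4 * (V + 2) / √l := by
  have hV : 0 ≤ V := by
    have h1 := hlo a le_rfl (by omega)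
    have h2 := hhi a le_rfl (by omega)
    linarith
  have hsq : 0 < √l := Real.sqrt_pos.2 hl
  have hsl : √l * √l = l := Real.mul_self_sqrt hl.le
  -- For small `l`, `θ = √l` balances `θ / l` against `1 / θ`, and there are at most `V + 2` fibres.
  -- For `l > 1/4` the trivial bound is enough: the differences grow by `l` each step within a range
  -- `V`, so there are few terms.
  rcases le_or_gt l (1 / 4) with hl4 | hl4
  · have hs2 : √l ≤ 1 / 2 := by
      rw [Real.sqrt_le_left (by norm_num)]
      norm_num
      linarith
    have hmaps : ∀ n ∈ Finset.Ico a b, ⌊f (n + 1) - f n⌋ ∈ Finset.Icc ⌊A⌋ ⌊A + V⌋ := by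
      intro n hn
      rw [Finset.mem_Ico] at hn
      exact Finset.mem_Icc.2 ⟨Int.floor_le_floor (hlo n hn.1 hn.2),
        Int.floor_le_floor (hhi n hn.1 hn.2)⟩
    rw [← Finset.sum_fiberwise_of_maps_to hmaps]
    refine (norm_sum_le _ _).trans ((Finset.sum_le_card_nsmul _ _ _
      fun m _ => norm_sum_fiber_expTwoPiI_le hl hsq hg m).trans ?_)
    rw [nsmul_eq_mul]
    have hcard : ((Finset.Icc ⌊A⌋ ⌊A + V⌋).card : ℝ) ≤ V + 2 := by
      rw [Int.card_Icc]
      have h1 : ⌊A⌋ ≤ ⌊A + V⌋ := Int.floor_le_floor (by linarith)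
      have h2 : (((⌊A + V⌋ + 1 - ⌊A⌋).toNat : ℤ) : ℝ) = ⌊A + V⌋ + 1 - ⌊A⌋ := by
        rw [Int.toNat_of_nonneg (by omega)]
        push_cast
        ring
      have h3 : (((⌊A + V⌋ + 1 - ⌊A⌋).toNat : ℕ) : ℝ) = ⌊A + V⌋ + 1 - ⌊A⌋ := by
        rw [← h2]
        norm_cast
      rw [h3]
      linarith [Int.floor_le (A + V), Int.lt_floor_add_one A]
    have h5 : √l / l = 1 / √l := by
      rw [div_eq_div_iff hl.ne' hsq.ne', hsl, one_mul]
    have h6 : 2 ≤ 1 / √l := by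
      rw [le_div_iff₀ hsq]
      linarith
    rw [h5]
    calc _ ≤ (V + 2) * (4 * (1 / √l)) := by
          apply mul_le_mul hcard _ (by positivity) (by linarith)
          linarith
      _ = _ := by ring
  · have h1 := norm_sum_expTwoPiI_le_card f (Finset.Ico a b)
    have h2 := mul_sub_le_of_forall_add_le (g := fun n => f (n + 1) - f n) hg le_rfl
      (show a ≤ b - 1 by omega) (by omega)
    have h3 := hlo a le_rfl (by omega)
    have h4 := hhi (b - 1) (by omega) (by omega)
    rw [Nat.card_Ico] at h1
    have h5 : ((b - a : ℕ) : ℝ) ≤ 2 * (((b - 1 : ℕ) : ℝ) - a) := by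
      rw [Nat.cast_sub (by omega), Nat.cast_sub (by omega)]
      have : (a : ℝ) + 2 ≤ b := by exact_mod_cast hab
      push_cast
      linarith
    have h6 : ((b - 1 : ℕ) : ℝ) - a ≤ V / l := by
      rw [le_div_iff₀ hl]
      linarith
    have h7 : 1 / 2 ≤ √l := Real.le_sqrt_of_sq_le (by norm_num; linarith)
    have h8 : 2 * (V / l) ≤ 4 * (V + 2) / √l := by
      have h9 : 2 * (V / l) = 2 * V / √l / √l := by rw [div_div, hsl, mul_div_assoc]
      rw [h9, div_le_div_iff_of_pos_right hsq, div_le_iff₀ hsq]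
      nlinarith
    linarith

/-! ### Sawtooth sums through the second Bernoulli function -/

/-- The sawtooth function `t ↦ {t} - 1/2`. -/
noncomputable def sawtooth (t : ℝ) : ℝ := Int.fract t - 1 / 2

theorem abs_sawtooth_le (t : ℝ) : |sawtooth t| ≤ 1 / 2 := by
  rw [sawtooth, abs_le]
  constructor <;> linarith [Int.fract_nonneg t, Int.fract_lt_one t]

theorem abs_sum_sawtooth_le_card {ι : Type*} (f : ι → ℝ) (S : Finset ι) :
    |∑ n ∈ S, sawtooth (f n)| ≤ S.card := by
  refine (Finset.abs_sum_le_sum_abs _ _).trans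
    ((Finset.sum_le_card_nsmul _ _ 1 fun n _ => (abs_sawtooth_le _).trans (by norm_num)).trans ?_)
  simp

/-- The `1`-periodic second Bernoulli function. -/
noncomputable def periodicBernoulliTwo (t : ℝ) : ℝ := Int.fract t ^ 2 - Int.fract t + 1 / 6

/-- The coefficients decay like h^(-2), so sums over n can be taken frequency by frequency. The
series of the sawtooth itself is not absolutely convergent. -/
theorem hasSum_periodicBernoulliTwo (t : ℝ) :
    HasSum (fun h : ℕ => 1 / (h : ℝ) ^ 2 * Real.cos (2 * Real.pi * (h * t)))
      (Real.pi ^ 2 * periodicBernoulliTwo t) := by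
  have h := hasSum_one_div_nat_pow_mul_cos one_ne_zero
    (x := Int.fract t) ⟨Int.fract_nonneg t, (Int.fract_lt_one t).le⟩
  convert h using 1
  · ext n
    have h1 : 2 * Real.pi * (n * t) = 2 * Real.pi * n * Int.fract t +
        ((n * ⌊t⌋ : ℤ) : ℝ) * (2 * Real.pi) := by
      push_cast
      nth_rewrite 1 [← Int.floor_add_fract t]
      ring
    rw [h1, Real.cos_add_int_mul_two_pi, mul_one]
  · have h2 : (Polynomial.map (algebraMap ℚ ℝ) (Polynomial.bernoulli (2 * 1))).eval (Int.fract t) =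
        Int.fract t ^ 2 - Int.fract t + 1 / 6 := by
      simp [Polynomial.bernoulli, Finset.sum_range_succ, Polynomial.eval_add, bernoulli_one,
        bernoulli_two, bernoulli_zero]
      ring
    rw [h2, periodicBernoulliTwo]
    have h3 : (-1 : ℝ) ^ (1 + 1) * (2 * Real.pi) ^ (2 * 1) / 2 / (Nat.factorial (2 * 1) : ℝ) =
        Real.pi ^ 2 := by
      rw [show (Nat.factorial (2 * 1) : ℝ) = 2 by norm_num [Nat.factorial]]
      ring
    rw [h3]

theorem fract_add_eq_or {t δ : ℝ} (h0 : 0 ≤ δ) (h1 : δ < 1) :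
    Int.fract (t + δ) = Int.fract t + δ ∨ Int.fract (t + δ) = Int.fract t + δ - 1 := by
  have h2 : t + δ = ⌊t⌋ + (Int.fract t + δ) := by
    nth_rewrite 1 [← Int.floor_add_fract t]
    ring
  have h3 := Int.fract_nonneg t
  have h4 := Int.fract_lt_one t
  rw [h2, Int.fract_intCast_add]
  rcases lt_or_ge (Int.fract t + δ) 1 with h | h
  · left
    exact Int.fract_eq_self.2 ⟨by linarith, h⟩
  · right
    rw [← Int.fract_sub_one]
    exact Int.fract_eq_self.2 ⟨by linarith, by linarith⟩

/-- Equality holds unless an integer is crossed between `t` and `t + δ`; the crossing lowers the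
left side by twice the fractional part of `t + δ`. -/
theorem periodicBernoulliTwo_sub_le {t δ : ℝ} (h0 : 0 < δ) (h1 : δ < 1) :
    periodicBernoulliTwo (t + δ) - periodicBernoulliTwo t ≤ 2 * δ * sawtooth t + δ ^ 2 := by
  have h3 := Int.fract_nonneg t
  have h4 := Int.fract_lt_one t
  have h5 := Int.fract_nonneg (t + δ)
  rw [periodicBernoulliTwo, periodicBernoulliTwo, sawtooth]
  rcases fract_add_eq_or (t := t) h0.le h1 with h | h <;> rw [h] at h5 ⊢ <;> nlinarith

theorem le_periodicBernoulliTwo_sub {t δ : ℝ} (h0 : 0 < δ) (h1 : δ < 1) :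
    2 * δ * sawtooth t - δ ^ 2 ≤ periodicBernoulliTwo t - periodicBernoulliTwo (t - δ) := by
  obtain ⟨u, rfl⟩ : ∃ u, t = u + δ := ⟨t - δ, by ring⟩
  have h3 := Int.fract_nonneg u
  have h4 := Int.fract_lt_one u
  have h5 := Int.fract_nonneg (u + δ)
  rw [periodicBernoulliTwo, periodicBernoulliTwo, sawtooth, add_sub_cancel_right]
  rcases fract_add_eq_or (t := u) h0.le h1 with h | h <;> rw [h] at h5 ⊢ <;> nlinarith

theorem norm_expTwoPiI_sub_one_le (t : ℝ) : ‖expTwoPiI t - 1‖ ≤ 2 * Real.pi * |t| := by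
  rw [expTwoPiI, mul_comm]
  refine Real.norm_exp_I_mul_ofReal_sub_one_le.trans ?_
  rw [Real.norm_eq_abs, abs_mul, abs_of_pos (by positivity)]

/-- A constant shift of the phase factors out of the exponential sum. -/
theorem abs_sum_cos_sub_cos_le (f : ℕ → ℝ) (S : Finset ℕ) (τ : ℝ) :
    |∑ n ∈ S, (Real.cos (2 * Real.pi * (f n + τ)) - Real.cos (2 * Real.pi * f n))| ≤
      ‖expTwoPiI τ - 1‖ * ‖∑ n ∈ S, expTwoPiI (f n)‖ := by
  have h : ∑ n ∈ S, (Real.cos (2 * Real.pi * (f n + τ)) - Real.cos (2 * Real.pi * f n)) =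
      ((expTwoPiI τ - 1) * ∑ n ∈ S, expTwoPiI (f n)).re := by
    rw [Finset.mul_sum, Complex.re_sum]
    refine Finset.sum_congr rfl fun n _ => ?_
    rw [sub_mul, one_mul, ← expTwoPiI_add, Complex.sub_re, expTwoPiI_re, expTwoPiI_re,
      add_comm τ]
  rw [h, ← norm_mul]
  exact Complex.abs_re_le_norm _

/-- The constant in the estimate `abs_sum_sawtooth_le`. -/
noncomputable def sawtoothConst : ℝ := 16 * ∑' h : ℕ, 1 / (h : ℝ) ^ (3 / 2 : ℝ)

theorem sawtoothConst_nonneg : 0 ≤ sawtoothConst :=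
  mul_nonneg (by norm_num) (tsum_nonneg fun _ => by positivity)

/-- An estimate for the increments of the Bernoulli function along a sequence with decreasing
differences. -/
theorem abs_sum_periodicBernoulliTwo_sub_le {f : ℕ → ℝ} {a b : ℕ} {l V : ℝ} (hl : 0 < l)
    (hab : a + 2 ≤ b)
    (hg : ∀ n, a ≤ n → n + 1 < b → f n - f (n + 1) + l ≤ f (n + 1) - f (n + 2))
    (hlo : ∀ n, a ≤ n → n < b → 0 ≤ f n - f (n + 1))
    (hhi : ∀ n, a ≤ n → n < b → f n - f (n + 1) ≤ V) (σ : ℝ) :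
    |∑ n ∈ Finset.Ico a b, (periodicBernoulliTwo (f n + σ) - periodicBernoulliTwo (f n))| ≤
      sawtoothConst * (V + |σ|) / √l := by
  have hV : 0 ≤ V := (hlo a le_rfl (by omega)).trans (hhi a le_rfl (by omega))
  have hsq : 0 < √l := Real.sqrt_pos.2 hl
  have hsum : HasSum (fun h : ℕ => 1 / (h : ℝ) ^ 2 * ∑ n ∈ Finset.Ico a b,
      (Real.cos (2 * Real.pi * (h * f n + h * σ)) - Real.cos (2 * Real.pi * (h * f n))))
      (Real.pi ^ 2 *
        ∑ n ∈ Finset.Ico a b, (periodicBernoulliTwo (f n + σ) - periodicBernoulliTwo (f n))) := by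
    simp_rw [Finset.mul_sum]
    refine hasSum_sum fun n _ => ?_
    convert! (hasSum_periodicBernoulliTwo (f n + σ)).sub (hasSum_periodicBernoulliTwo (f n)) using 1
    · ext h
      rw [mul_sub, ← mul_add (h : ℝ)]
    · rw [mul_sub]
  have hterm : ∀ h : ℕ, ‖1 / (h : ℝ) ^ 2 * ∑ n ∈ Finset.Ico a b,
      (Real.cos (2 * Real.pi * (h * f n + h * σ)) - Real.cos (2 * Real.pi * (h * f n)))‖ ≤
      (16 * Real.pi * (V + |σ|) / √l) * (1 / (h : ℝ) ^ (3 / 2 : ℝ)) := by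
    intro h
    rcases Nat.eq_zero_or_pos h with rfl | hpos
    · simp
    have hp : (0 : ℝ) < h := by exact_mod_cast hpos
    have h1 := abs_sum_cos_sub_cos_le (fun n => h * f n) (Finset.Ico a b) (h * σ)
    have h2 : ‖∑ n ∈ Finset.Ico a b, expTwoPiI (h * f n)‖ ≤ 4 * (h * V + 2) / √(h * l) := by
      -- The differences of `f` decrease, so the test is applied to the negated phase; conjugation
      -- preserves the norm.
      have h3 := norm_sum_expTwoPiI_le_of_second_difference (f := fun n => -(h * f n)) (a := a)
        (b := b) (l := h * l) (A := 0) (V := h * V) (by positivity) hab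
        (fun n i j => by have := hg n i j; nlinarith)
        (fun n i j => by have := hlo n i j; nlinarith)
        (fun n i j => by have := hhi n i j; nlinarith)
      rw [← Complex.norm_conj, map_sum]
      convert h3 using 3 with n
      rw [expTwoPiI, expTwoPiI, ← Complex.exp_conj, map_mul, Complex.conj_ofReal, Complex.conj_I]
      push_cast
      congr 1
      ring
    have h4 : √(h * l) = √h * √l := Real.sqrt_mul hp.le l
    have hsh : 0 < √(h : ℝ) := Real.sqrt_pos.2 hp
    have h5 : ‖expTwoPiI (h * σ) - 1‖ ≤ 2 := by
      refine (norm_sub_le _ _).trans ?_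
      rw [norm_expTwoPiI, norm_one]
      norm_num
    have h6 : ‖expTwoPiI (h * σ) - 1‖ ≤ 2 * Real.pi * (h * |σ|) := by
      refine (norm_expTwoPiI_sub_one_le _).trans ?_
      rw [abs_mul, abs_of_pos hp]
    have h7 : (h : ℝ) ^ (3 / 2 : ℝ) = h * √h := by
      rw [show (3 / 2 : ℝ) = 1 + 1 / 2 by norm_num, Real.rpow_add hp, Real.rpow_one,
        Real.sqrt_eq_rpow]
    have h8 : (h : ℝ) = √h * √h := (Real.mul_self_sqrt hp.le).symm
    rw [norm_mul, Real.norm_eq_abs, Real.norm_eq_abs, abs_of_pos (a := 1 / (h : ℝ) ^ 2)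
      (by positivity)]
    have hpi := Real.pi_gt_three
    -- The factor |e(hσ) - 1| is bounded by 2 against `h * V` and by 2πh|σ| against the constant.
    -- Both parts are then linear in h, and dividing by h^2 √h leaves the summable h^(-3/2).
    have hM : ‖expTwoPiI (h * σ) - 1‖ * (4 * (h * V + 2)) ≤ 16 * Real.pi * (V + |σ|) * h := by
      have e1 : ‖expTwoPiI (h * σ) - 1‖ * (4 * (h * V)) ≤ 2 * (4 * (h * V)) :=
        mul_le_mul_of_nonneg_right h5 (by positivity)
      have e2 : 0 ≤ h * V := by positivity
      nlinarith
    calc 1 / (h : ℝ) ^ 2 * _ ≤ 1 / (h : ℝ) ^ 2 *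
          (‖expTwoPiI (h * σ) - 1‖ * (4 * (h * V + 2) / √(h * l))) :=
          mul_le_mul_of_nonneg_left
            (h1.trans (mul_le_mul_of_nonneg_left h2 (norm_nonneg _))) (by positivity)
      _ = (‖expTwoPiI (h * σ) - 1‖ * (4 * (h * V + 2))) * (1 / ((h : ℝ) ^ 2 * √(h * l))) := by
          field_simp
      _ ≤ (16 * Real.pi * (V + |σ|) * h) * (1 / ((h : ℝ) ^ 2 * √(h * l))) :=
          mul_le_mul_of_nonneg_right hM (by positivity)
      _ = _ := by
          rw [h4, h7]
          field_simp
  have hsummable : Summable fun h : ℕ => (16 * Real.pi * (V + |σ|) / √l) *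
      (1 / (h : ℝ) ^ (3 / 2 : ℝ)) :=
    (Real.summable_one_div_nat_rpow.2 (by norm_num)).mul_left _
  have h9 := tsum_of_norm_bounded hsummable.hasSum hterm
  rw [hsum.tsum_eq, tsum_mul_left, Real.norm_eq_abs, abs_mul,
    abs_of_pos (a := Real.pi ^ 2) (by positivity)] at h9
  have hpi := Real.pi_gt_three
  have h10 : Real.pi * |∑ n ∈ Finset.Ico a b,
      (periodicBernoulliTwo (f n + σ) - periodicBernoulliTwo (f n))| ≤
      sawtoothConst * (V + |σ|) / √l := by
    rw [← mul_le_mul_iff_right₀ Real.pi_pos]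
    refine le_trans (le_of_eq (by ring)) (h9.trans (le_of_eq ?_))
    rw [sawtoothConst]
    ring
  refine le_trans ?_ h10
  exact le_mul_of_one_le_left (abs_nonneg _) (by linarith)

/-- The sawtooth sum along a sequence with decreasing differences, with a smoothing parameter. -/
theorem abs_sum_sawtooth_le {f : ℕ → ℝ} {a b : ℕ} {l V δ : ℝ} (hl : 0 < l) (h0 : 0 < δ)
    (h1 : δ < 1) (hV : 0 ≤ V)
    (hg : ∀ n, a ≤ n → n + 1 < b → f n - f (n + 1) + l ≤ f (n + 1) - f (n + 2))
    (hlo : ∀ n, a ≤ n → n < b → 0 ≤ f n - f (n + 1))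
    (hhi : ∀ n, a ≤ n → n < b → f n - f (n + 1) ≤ V) :
    |∑ n ∈ Finset.Ico a b, sawtooth (f n)| ≤
      (b - a : ℕ) * δ + sawtoothConst * (V / δ + 1) / √l + 1 := by
  have hK := sawtoothConst_nonneg
  rcases lt_or_ge b (a + 2) with hab | hab
  · refine (abs_sum_sawtooth_le_card _ _).trans ?_
    rw [Nat.card_Ico]
    have h2 : ((b - a : ℕ) : ℝ) ≤ 1 := by
      have : b - a ≤ 1 := by omega
      exact_mod_cast this
    have h3 : 0 ≤ ((b - a : ℕ) : ℝ) * δ := by positivity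
    have h4 : 0 ≤ sawtoothConst * (V / δ + 1) / √l := by positivity
    linarith
  -- The shift by `δ` bounds the sawtooth sum from below, the shift by `-δ` from above.
  have h2 := abs_le.1 (abs_sum_periodicBernoulliTwo_sub_le hl hab hg hlo hhi δ)
  have h3 := abs_le.1 (abs_sum_periodicBernoulliTwo_sub_le hl hab hg hlo hhi (-δ))
  rw [abs_neg] at h3
  rw [abs_of_pos h0] at h2 h3
  have h4 : sawtoothConst * (V + δ) / √l = δ * (sawtoothConst * (V / δ + 1) / √l) := by
    field_simp
  have h5 : 0 ≤ sawtoothConst * (V / δ + 1) / √l := by positivity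
  rw [h4] at h2 h3
  have h6 := Finset.sum_le_sum fun n (_ : n ∈ Finset.Ico a b) =>
    periodicBernoulliTwo_sub_le (t := f n) h0 h1
  have h7 := Finset.sum_le_sum fun n (_ : n ∈ Finset.Ico a b) =>
    le_periodicBernoulliTwo_sub (t := f n) h0 h1
  rw [Finset.sum_add_distrib, ← Finset.mul_sum, Finset.sum_const, Nat.card_Ico,
    nsmul_eq_mul] at h6
  rw [Finset.sum_sub_distrib, ← Finset.mul_sum, Finset.sum_const, Nat.card_Ico,
    nsmul_eq_mul] at h7
  simp_rw [← sub_eq_add_neg] at h3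
  have h8 : ∑ n ∈ Finset.Ico a b, (periodicBernoulliTwo (f n) - periodicBernoulliTwo (f n - δ)) =
      -∑ n ∈ Finset.Ico a b, (periodicBernoulliTwo (f n - δ) - periodicBernoulliTwo (f n)) := by
    rw [← Finset.sum_neg_distrib]
    simp
  have hY : 0 ≤ ((b - a : ℕ) : ℝ) * δ := by positivity
  set W := sawtoothConst * (V / δ + 1) / √l
  set Y := ((b - a : ℕ) : ℝ)
  rw [abs_le]
  constructor
  · have : -(δ * W) ≤ 2 * δ * ∑ n ∈ Finset.Ico a b, sawtooth (f n) + Y * δ ^ 2 := by linarith [h2.1]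
    have : 0 ≤ δ * (2 * ∑ n ∈ Finset.Ico a b, sawtooth (f n) + Y * δ + W) := by nlinarith
    have := nonneg_of_mul_nonneg_right this h0
    linarith
  · have : 2 * δ * ∑ n ∈ Finset.Ico a b, sawtooth (f n) - Y * δ ^ 2 ≤ δ * W := by linarith [h3.1]
    have : 0 ≤ δ * (-2 * ∑ n ∈ Finset.Ico a b, sawtooth (f n) + Y * δ + W) := by nlinarith
    have := nonneg_of_mul_nonneg_right this h0
    linarith

/-- The sawtooth sum over a dilated piece of a concave decreasing curve. -/
theorem abs_sum_sawtooth_dilate_le {F P P' : ℝ → ℝ} {u v L V R : ℝ} (hu : 0 ≤ u) (huv : u ≤ v)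
    (hL : 0 < L) (hR : 1 < R)
    (hF : ∀ t ∈ Set.Icc u v, HasDerivAt F (-P t) t)
    (hP : ∀ t ∈ Set.Icc u v, HasDerivAt P (P' t) t)
    (hP' : ∀ t ∈ Set.Icc u v, L ≤ P' t)
    (hP0 : ∀ t ∈ Set.Icc u v, 0 ≤ P t) (hPV : ∀ t ∈ Set.Icc u v, P t ≤ V) :
    |∑ n ∈ Finset.Ioc ⌊R * u⌋₊ ⌊R * v⌋₊, sawtooth (R * F (n / R))| ≤
      (v - u) * R ^ (3 / 4 : ℝ) +
        sawtoothConst * (V * R ^ (3 / 4 : ℝ) + R ^ (1 / 2 : ℝ)) / √L + 2 := by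
  have hR0 : 0 < R := by linarith
  have hV : 0 ≤ V := (hP0 u ⟨le_rfl, huv⟩).trans (hPV u ⟨le_rfl, huv⟩)
  have hslope : ∀ s t, u ≤ s → s < t → t ≤ v → ∃ ξ ∈ Set.Icc s t, F s - F t = P ξ * (t - s) := by
    intro s t h1 h2 h3
    obtain ⟨ξ, hξ, h4⟩ := exists_hasDerivAt_eq_slope F (fun x => -P x) h2
      (fun x hx => (hF x ⟨h1.trans hx.1, hx.2.trans h3⟩).continuousAt.continuousWithinAt)
      (fun x hx => hF x ⟨h1.trans hx.1.le, hx.2.le.trans h3⟩)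
    refine ⟨ξ, ⟨hξ.1.le, hξ.2.le⟩, ?_⟩
    rw [eq_div_iff (by linarith)] at h4
    linarith
  have hPs : ∀ s t, u ≤ s → s < t → t ≤ v → L * (t - s) ≤ P t - P s := by
    intro s t h1 h2 h3
    obtain ⟨ξ, hξ, h4⟩ := exists_hasDerivAt_eq_slope P P' h2
      (fun x hx => (hP x ⟨h1.trans hx.1, hx.2.trans h3⟩).continuousAt.continuousWithinAt)
      (fun x hx => hP x ⟨h1.trans hx.1.le, hx.2.le.trans h3⟩)
    rw [eq_div_iff (by linarith)] at h4
    rw [← h4]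
    exact mul_le_mul_of_nonneg_right (hP' ξ ⟨h1.trans hξ.1.le, hξ.2.le.trans h3⟩) (by linarith)
  -- The mean value theorem for F(x) - F(x + d), then for `P`.
  have hsecond : ∀ s d, u ≤ s → 0 < d → s + 2 * d ≤ v →
      F s - F (s + d) + L * d ^ 2 ≤ F (s + d) - F (s + 2 * d) := by
    intro s d h1 h2 h3
    have hd : ∀ x ∈ Set.Icc s (s + d),
        HasDerivAt (fun x => F x - F (x + d)) (-P x - -P (x + d)) x := fun x hx =>
      (hF x ⟨h1.trans hx.1, by linarith [hx.2]⟩).sub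
        ((hF (x + d) ⟨by linarith [hx.1], by linarith [hx.2]⟩).comp_add_const x d)
    obtain ⟨ξ, hξ, h4⟩ := exists_hasDerivAt_eq_slope (fun x => F x - F (x + d))
      (fun x => -P x - -P (x + d)) (show s < s + d by linarith)
      (fun x hx => (hd x hx).continuousAt.continuousWithinAt)
      (fun x hx => hd x ⟨hx.1.le, hx.2.le⟩)
    rw [eq_div_iff (by linarith), show s + d + d = s + 2 * d by ring] at h4
    have h5 := hPs ξ (ξ + d) (by linarith [hξ.1]) (by linarith) (by linarith [hξ.2])
    nlinarith
  set A := ⌊R * u⌋₊ with hA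
  set B := ⌊R * v⌋₊ with hB
  have hAB : A ≤ B := Nat.floor_le_floor (by gcongr)
  have hmem : ∀ n : ℕ, A + 1 ≤ n → n ≤ B → u ≤ n / R ∧ (n : ℝ) / R ≤ v := by
    intro n h1 h2
    rw [le_div_iff₀ hR0, div_le_iff₀ hR0]
    have h3 : R * u < n := (Nat.floor_lt (by positivity)).1 (by omega)
    have h4 : (n : ℝ) ≤ R * v := (Nat.le_floor_iff (by have := hu.trans huv; positivity)).1 h2
    constructor <;> linarith
  have hdiv : ∀ n : ℕ, ((n + 1 : ℕ) : ℝ) / R = n / R + 1 / R := fun n => by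
    push_cast
    ring
  have hdiv2 : ∀ n : ℕ, ((n + 2 : ℕ) : ℝ) / R = n / R + 2 * (1 / R) := fun n => by
    push_cast
    ring
  have hR1 : 0 < 1 / R := by positivity
  -- With about (v - u) R terms and second differences at least `L / R`, this `δ` makes both the
  -- smoothing loss and the `V / δ` term of order R^(3/4).
  set δ : ℝ := R ^ (-(1 / 4) : ℝ) with hδ
  have hδ0 : 0 < δ := Real.rpow_pos_of_pos hR0 _
  have hδ1 : δ < 1 := Real.rpow_lt_one_of_one_lt_of_neg hR (by norm_num)
  have hfirst : ∀ n : ℕ, A + 1 ≤ n → n < B → ∃ ξ ∈ Set.Icc u v,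
      R * F (n / R) - R * F ((n + 1 : ℕ) / R) = P ξ := by
    intro n h1 h2
    have h3 := hmem n h1 h2.le
    have h4 := hmem (n + 1) (by omega) (by omega)
    rw [hdiv] at h4 ⊢
    obtain ⟨ξ, hξ, h5⟩ := hslope (n / R) (n / R + 1 / R) h3.1 (by linarith) h4.2
    refine ⟨ξ, ⟨h3.1.trans hξ.1, hξ.2.trans h4.2⟩, ?_⟩
    rw [← mul_sub, h5]
    field_simp
    ring
  have main := abs_sum_sawtooth_le (f := fun n : ℕ => R * F (n / R)) (a := A + 1) (b := B)
    (l := L / R) (V := V) (δ := δ) (by positivity) hδ0 hδ1 hV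
    (by
      intro n h1 h2
      have h3 := hmem n h1 (by omega)
      have h4 := hmem (n + 2) (by omega) (by omega)
      rw [hdiv2] at h4 ⊢
      rw [hdiv]
      have h5 := hsecond (n / R) (1 / R) h3.1 hR1 h4.2
      have h6 : R * (L * (1 / R) ^ 2) = L / R := by field_simp
      have h7 := mul_le_mul_of_nonneg_left h5 hR0.le
      linarith)
    (by
      intro n h1 h2
      obtain ⟨ξ, hξ, h3⟩ := hfirst n h1 h2
      rw [h3]
      exact hP0 ξ hξ)
    (by
      intro n h1 h2
      obtain ⟨ξ, hξ, h3⟩ := hfirst n h1 h2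
      rw [h3]
      exact hPV ξ hξ)
  have hK := sawtoothConst_nonneg
  -- The last index is set aside, because the differences at `n` need `n + 1 ≤ B`; this costs one
  -- more unit.
  have hsplit : |∑ n ∈ Finset.Ioc A B, sawtooth (R * F (n / R))| ≤
      |∑ n ∈ Finset.Ico (A + 1) B, sawtooth (R * F (n / R))| + 1 := by
    rcases hAB.eq_or_lt with h | h
    · rw [← h]
      simp
    · have : Finset.Ioc A B = Finset.Ico (A + 1) (B + 1) := by
        ext n
        simp only [Finset.mem_Ioc, Finset.mem_Ico]
        omega
      rw [this, Finset.sum_Ico_succ_top (by omega)]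
      refine (abs_add_le _ _).trans ?_
      have := abs_sawtooth_le (R * F ((B : ℕ) / R))
      linarith
  have hcount : ((B - (A + 1) : ℕ) : ℝ) ≤ (v - u) * R := by
    rcases le_total (A + 1) B with h | h
    · rw [Nat.cast_sub h]
      have h1 : (B : ℝ) ≤ R * v := Nat.floor_le (by have := hu.trans huv; positivity)
      have h2 : R * u < A + 1 := Nat.lt_floor_add_one _
      push_cast
      linarith
    · rw [Nat.sub_eq_zero_of_le h, Nat.cast_zero]
      exact mul_nonneg (by linarith) hR0.le
  have e1 : R * δ = R ^ (3 / 4 : ℝ) := by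
    rw [hδ]
    nth_rewrite 1 [← Real.rpow_one R]
    rw [← Real.rpow_add hR0]
    norm_num
  have e2 : 1 / δ * R ^ (1 / 2 : ℝ) = R ^ (3 / 4 : ℝ) := by
    rw [hδ, one_div, ← Real.rpow_neg hR0.le, ← Real.rpow_add hR0]
    norm_num
  have e3 : sawtoothConst * (V / δ + 1) / √(L / R) =
      sawtoothConst * (V * R ^ (3 / 4 : ℝ) + R ^ (1 / 2 : ℝ)) / √L := by
    rw [Real.sqrt_div hL.le, ← e2, Real.sqrt_eq_rpow R]
    field_simp
  have e4 : ((B - (A + 1) : ℕ) : ℝ) * δ ≤ (v - u) * R ^ (3 / 4 : ℝ) := by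
    rw [← e1, ← mul_assoc]
    exact mul_le_mul_of_nonneg_right hcount hδ0.le
  rw [e3] at main
  linarith

/-! ### Dyadic pieces of the superellipse -/

section Superellipse

variable {k : ℕ}

/-- The arc `u ↦ (1 - u ^ k) ^ (1 / k)` of the superellipse. -/
noncomputable def superellipse (k : ℕ) (u : ℝ) : ℝ := (1 - u ^ k) ^ (1 / k : ℝ)

theorem hasDerivAt_one_sub_pow_rpow {u : ℝ} (h : 0 < 1 - u ^ k) (α : ℝ) :
    HasDerivAt (fun u : ℝ => (1 - u ^ k) ^ α) (-(k * α * u ^ (k - 1) * (1 - u ^ k) ^ (α - 1))) u := by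
  have := ((hasDerivAt_pow k u).const_sub 1).rpow_const (p := α) (Or.inl h.ne')
  convert this using 1
  ring

theorem hasDerivAt_superellipse (hk : k ≠ 0) {u : ℝ} (h : 0 < 1 - u ^ k) :
    HasDerivAt (superellipse k) (-(u ^ (k - 1) * (1 - u ^ k) ^ (1 / k - 1 : ℝ))) u := by
  refine (hasDerivAt_one_sub_pow_rpow h (1 / k : ℝ)).congr_deriv ?_
  have : (k : ℝ) ≠ 0 := by exact_mod_cast hk
  rw [mul_one_div_cancel this, one_mul]

/-- On the arc both terms are nonnegative. The first gives the lower bound for the curvature near 0,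
the second near 1. -/
theorem hasDerivAt_superellipse_slope (hk : 1 ≤ k) {u : ℝ} (h : 0 < 1 - u ^ k) :
    HasDerivAt (fun u : ℝ => u ^ (k - 1) * (1 - u ^ k) ^ (1 / k - 1 : ℝ))
      ((k - 1) * u ^ (k - 2) * (1 - u ^ k) ^ (1 / k - 1 : ℝ) +
        (k - 1) * (u ^ (k - 1) * u ^ (k - 1)) * (1 - u ^ k) ^ (1 / k - 2 : ℝ)) u := by
  refine ((hasDerivAt_pow (k - 1) u).mul
    (hasDerivAt_one_sub_pow_rpow h (1 / k - 1 : ℝ))).congr_deriv ?_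
  have hk0 : (k : ℝ) ≠ 0 := by
    have : k ≠ 0 := by omega
    exact_mod_cast this
  have h1 : (k : ℝ) * (1 / k - 1) = -(k - 1) := by
    field_simp
    ring
  rw [h1, show (1 / k - 1 - 1 : ℝ) = 1 / k - 2 by ring, Nat.cast_sub hk, Nat.sub_sub]
  push_cast
  ring

/-- On [τ, 2τ] the slope is at most 2^k τ^(k-1) and the curvature at least τ^(k-2). Dividing by the
root of the curvature produces the negative power of τ. -/
theorem abs_sum_sawtooth_superellipse_low_le (hk : 4 ≤ k) {τ R : ℝ} (hτ : 0 < τ) (hτ4 : τ ≤ 1 / 4)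
    (hR : 1 < R) :
    |∑ n ∈ Finset.Ioc ⌊R * τ⌋₊ ⌊R * (2 * τ)⌋₊, sawtooth (R * superellipse k (n / R))| ≤
      τ * R ^ (3 / 4 : ℝ) + sawtoothConst * (2 ^ k * τ * R ^ (3 / 4 : ℝ) +
        R ^ (1 / 2 : ℝ) * τ ^ (-((k - 2) / 2) : ℝ)) + 2 := by
  have hR0 : 0 < R := by linarith
  have hk4 : (4 : ℝ) ≤ k := by exact_mod_cast hk
  have hw : ∀ t ∈ Set.Icc τ (2 * τ), 1 / 2 ≤ 1 - t ^ k := by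
    intro t ht
    have h1 : t ^ k ≤ t ^ 1 := pow_le_pow_of_le_one (hτ.le.trans ht.1) (by linarith [ht.2]) (by omega)
    rw [pow_one] at h1
    linarith [ht.2]
  have hw1 : ∀ t ∈ Set.Icc τ (2 * τ), 1 - t ^ k ≤ 1 := by
    intro t ht
    have := pow_nonneg (hτ.le.trans ht.1) k
    linarith
  have hexp : (1 / k - 1 : ℝ) ≤ 0 := by
    have : (1 / k : ℝ) ≤ 1 := by
      rw [div_le_one (by linarith)]
      linarith
    linarith
  have hexp' : (-1 : ℝ) ≤ 1 / k - 1 := by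
    have : (0 : ℝ) ≤ 1 / k := by positivity
    linarith
  have hQ1 : ∀ t ∈ Set.Icc τ (2 * τ), 1 ≤ (1 - t ^ k) ^ (1 / k - 1 : ℝ) := fun t ht =>
    Real.one_le_rpow_of_pos_of_le_one_of_nonpos (by linarith [hw t ht]) (hw1 t ht) hexp
  have hQ2 : ∀ t ∈ Set.Icc τ (2 * τ), (1 - t ^ k) ^ (1 / k - 1 : ℝ) ≤ 2 := by
    intro t ht
    calc (1 - t ^ k) ^ (1 / k - 1 : ℝ) ≤ (1 - t ^ k) ^ (-1 : ℝ) :=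
          Real.rpow_le_rpow_of_exponent_ge (by linarith [hw t ht]) (hw1 t ht) hexp'
      _ = (1 - t ^ k)⁻¹ := Real.rpow_neg_one _
      _ ≤ (1 / 2)⁻¹ := inv_anti₀ (by norm_num) (hw t ht)
      _ = 2 := by norm_num
  have hb := abs_sum_sawtooth_dilate_le (F := superellipse k) (L := τ ^ (k - 2))
    (V := 2 ^ k * τ ^ (k - 1)) hτ.le (show τ ≤ 2 * τ by linarith) (by positivity) hR
    (fun t ht => hasDerivAt_superellipse (by omega) (by linarith [hw t ht]))
    (fun t ht => hasDerivAt_superellipse_slope (by omega) (by linarith [hw t ht]))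
    (by
      intro t ht
      have ht0 : 0 ≤ t := hτ.le.trans ht.1
      have h1 : τ ^ (k - 2) ≤ t ^ (k - 2) := pow_le_pow_left₀ hτ.le ht.1 _
      have h2 : 0 ≤ (k - 1) * (t ^ (k - 1) * t ^ (k - 1)) * (1 - t ^ k) ^ (1 / k - 2 : ℝ) := by
        have : 0 ≤ (1 - t ^ k) ^ (1 / k - 2 : ℝ) := Real.rpow_nonneg (by linarith [hw t ht]) _
        have : (0 : ℝ) ≤ k - 1 := by linarith
        positivity
      have h3 : t ^ (k - 2) ≤ (k - 1) * t ^ (k - 2) * (1 - t ^ k) ^ (1 / k - 1 : ℝ) := by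
        have h4 : t ^ (k - 2) ≤ (k - 1) * t ^ (k - 2) :=
          le_mul_of_one_le_left (by positivity) (by linarith)
        exact h4.trans (le_mul_of_one_le_right (h4.trans' (by positivity)) (hQ1 t ht))
      linarith)
    (by
      intro t ht
      have ht0 : 0 ≤ t := hτ.le.trans ht.1
      exact mul_nonneg (by positivity) (by linarith [hQ1 t ht]))
    (by
      intro t ht
      have ht0 : 0 ≤ t := hτ.le.trans ht.1
      calc t ^ (k - 1) * (1 - t ^ k) ^ (1 / k - 1 : ℝ) ≤ (2 * τ) ^ (k - 1) * 2 :=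
            mul_le_mul (pow_le_pow_left₀ ht0 ht.2 _) (hQ2 t ht) (by linarith [hQ1 t ht])
              (by positivity)
        _ = 2 ^ k * τ ^ (k - 1) := by
            rw [mul_pow]
            nth_rewrite 3 [show k = (k - 1) + 1 by omega]
            rw [pow_succ]
            ring)
  have hs : √(τ ^ (k - 2)) = τ ^ ((k - 2) / 2 : ℝ) := by
    rw [Real.sqrt_eq_rpow, ← Real.rpow_natCast, ← Real.rpow_mul hτ.le, Nat.cast_sub (by omega)]
    congr 1
    push_cast
    ring
  have h1 : τ ^ (k - 1) / τ ^ ((k - 2) / 2 : ℝ) ≤ τ := by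
    rw [← Real.rpow_natCast, ← Real.rpow_sub hτ]
    nth_rewrite 2 [← Real.rpow_one τ]
    apply Real.rpow_le_rpow_of_exponent_ge hτ (by linarith)
    rw [Nat.cast_sub (by omega)]
    push_cast
    linarith
  have h2 : 1 / τ ^ ((k - 2) / 2 : ℝ) = τ ^ (-((k - 2) / 2) : ℝ) := by
    rw [Real.rpow_neg hτ.le, one_div]
  rw [hs] at hb
  have h3 : sawtoothConst * (2 ^ k * τ ^ (k - 1) * R ^ (3 / 4 : ℝ) + R ^ (1 / 2 : ℝ)) /
      τ ^ ((k - 2) / 2 : ℝ) = sawtoothConst * (2 ^ k * (τ ^ (k - 1) / τ ^ ((k - 2) / 2 : ℝ)) *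
        R ^ (3 / 4 : ℝ) + R ^ (1 / 2 : ℝ) * τ ^ (-((k - 2) / 2) : ℝ)) := by
    rw [← h2]
    ring
  rw [h3] at hb
  have hK := sawtoothConst_nonneg
  refine hb.trans ?_
  rw [show 2 * τ - τ = τ by ring]
  gcongr

/-- Here 1 - u^k lies between τ and 2kτ, so the slope is at most τ^(1/k-1) and the curvature is at
least a constant times τ^(1/k-2). Slope over root of curvature is then O(τ^(1/(2k))), a small gain
that makes the dyadic sum converge. -/
theorem abs_sum_sawtooth_superellipse_high_le (hk : 4 ≤ k) {τ R : ℝ} (hτ : 0 < τ) (hτ4 : τ ≤ 1 / 4)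
    (hR : 1 < R) :
    |∑ n ∈ Finset.Ioc ⌊R * (1 - 2 * τ)⌋₊ ⌊R * (1 - τ)⌋₊, sawtooth (R * superellipse k (n / R))| ≤
      τ * R ^ (3 / 4 : ℝ) + sawtoothConst * (2 ^ k * k) * (τ ^ (1 / (2 * k) : ℝ) * R ^ (3 / 4 : ℝ) +
        R ^ (1 / 2 : ℝ)) + 2 := by
  have hR0 : 0 < R := by linarith
  have hk4 : (4 : ℝ) ≤ k := by exact_mod_cast hk
  have hk0 : (0 : ℝ) < k := by linarith
  have hinv : (0 : ℝ) < 1 / k := by positivity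
  have hinv1 : (1 / k : ℝ) ≤ 1 := by
    rw [div_le_one (by linarith)]
    linarith
  have ht0 : ∀ t ∈ Set.Icc (1 - 2 * τ) (1 - τ), 1 / 2 ≤ t := fun t ht => by linarith [ht.1]
  have hwlo : ∀ t ∈ Set.Icc (1 - 2 * τ) (1 - τ), τ ≤ 1 - t ^ k := by
    intro t ht
    have h1 : t ^ k ≤ t ^ 1 :=
      pow_le_pow_of_le_one (by linarith [ht0 t ht]) (by linarith [ht.2]) (by omega)
    rw [pow_one] at h1
    linarith [ht.2]
  have hwhi : ∀ t ∈ Set.Icc (1 - 2 * τ) (1 - τ), 1 - t ^ k ≤ 2 * k * τ := by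
    intro t ht
    have h1 := one_add_mul_le_pow (a := t - 1) (by linarith [ht0 t ht]) k
    rw [add_sub_cancel] at h1
    nlinarith [ht.1]
  have hb := abs_sum_sawtooth_dilate_le (F := superellipse k)
    (L := (1 / (2 ^ k * k)) ^ 2 * τ ^ (1 / k - 2 : ℝ))
    (V := τ ^ (1 / k - 1 : ℝ)) (u := 1 - 2 * τ) (v := 1 - τ) (by linarith) (by linarith)
    (by positivity) hR
    (fun t ht => hasDerivAt_superellipse (by omega) (by linarith [hwlo t ht]))
    (fun t ht => hasDerivAt_superellipse_slope (by omega) (by linarith [hwlo t ht]))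
    (by
      intro t ht
      have htp : 0 ≤ t := by linarith [ht0 t ht]
      have hw := hwlo t ht
      have hwp : 0 < 1 - t ^ k := by linarith
      have h2 : 0 ≤ (k - 1) * t ^ (k - 2) * (1 - t ^ k) ^ (1 / k - 1 : ℝ) := by
        have : (0 : ℝ) ≤ k - 1 := by linarith
        positivity
      have h3 : (2 * k * τ) ^ (1 / k - 2 : ℝ) ≤ (1 - t ^ k) ^ (1 / k - 2 : ℝ) :=
        Real.rpow_le_rpow_of_nonpos hwp (hwhi t ht) (by linarith)
      have h4 : (1 / (2 * k) : ℝ) ^ 2 ≤ (2 * k : ℝ) ^ (1 / k - 2 : ℝ) := by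
        calc (1 / (2 * k) : ℝ) ^ 2 = (2 * k : ℝ) ^ (-2 : ℝ) := by
              rw [Real.rpow_neg (by positivity), one_div, inv_pow, Real.rpow_two]
          _ ≤ _ := Real.rpow_le_rpow_of_exponent_le (by linarith) (by linarith)
      rw [Real.mul_rpow (by positivity) hτ.le] at h3
      have h5 : (1 / 2 : ℝ) ^ (k - 1) ≤ t ^ (k - 1) := pow_le_pow_left₀ (by norm_num) (ht0 t ht) _
      have h6 : (1 / (2 ^ k * k) : ℝ) ^ 2 =
          ((1 / 2 : ℝ) ^ (k - 1) * (1 / 2 : ℝ) ^ (k - 1)) * (1 / (2 * k)) ^ 2 := by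
        have : (2 : ℝ) ^ k = 2 ^ (k - 1) * 2 := by
          rw [← pow_succ]
          congr 1
          omega
        rw [this]
        simp only [one_div, inv_pow, mul_pow, mul_inv]
        ring
      have h7 : 0 ≤ τ ^ (1 / k - 2 : ℝ) := by positivity
      calc (1 / (2 ^ k * k)) ^ 2 * τ ^ (1 / k - 2 : ℝ)
          = ((1 / 2 : ℝ) ^ (k - 1) * (1 / 2 : ℝ) ^ (k - 1)) *
              ((1 / (2 * k)) ^ 2 * τ ^ (1 / k - 2 : ℝ)) := by rw [h6, mul_assoc]
        _ ≤ (t ^ (k - 1) * t ^ (k - 1)) * (1 - t ^ k) ^ (1 / k - 2 : ℝ) := by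
            have := (mul_le_mul_of_nonneg_right h4 h7).trans h3
            gcongr
        _ ≤ (k - 1) * (t ^ (k - 1) * t ^ (k - 1)) * (1 - t ^ k) ^ (1 / k - 2 : ℝ) := by
            rw [mul_assoc (k - 1 : ℝ)]
            exact le_mul_of_one_le_left (by positivity) (by linarith)
        _ ≤ _ := by linarith)
    (by
      intro t ht
      have htp : 0 ≤ t := by linarith [ht0 t ht]
      have hw := hwlo t ht
      have hwp : 0 < 1 - t ^ k := by linarith
      positivity)
    (by
      intro t ht
      have htp : 0 ≤ t := by linarith [ht0 t ht]
      have hw := hwlo t ht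
      have hwp : 0 < 1 - t ^ k := by linarith
      calc t ^ (k - 1) * (1 - t ^ k) ^ (1 / k - 1 : ℝ) ≤ 1 * τ ^ (1 / k - 1 : ℝ) :=
            mul_le_mul (pow_le_one₀ htp (by linarith [ht.2]))
              (Real.rpow_le_rpow_of_nonpos hτ hw (by linarith)) (by positivity) zero_le_one
        _ = _ := one_mul _)
  have hs : √((1 / (2 ^ k * k)) ^ 2 * τ ^ (1 / k - 2 : ℝ)) =
      1 / (2 ^ k * k) * τ ^ (1 / (2 * k) - 1 : ℝ) := by
    rw [Real.sqrt_mul (by positivity), Real.sqrt_sq (by positivity), Real.sqrt_eq_rpow,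
      ← Real.rpow_mul hτ.le]
    congr 2
    field_simp
  rw [hs] at hb
  have h1 : τ ^ (1 / k - 1 : ℝ) / τ ^ (1 / (2 * k) - 1 : ℝ) = τ ^ (1 / (2 * k) : ℝ) := by
    rw [← Real.rpow_sub hτ]
    congr 1
    field_simp
    ring
  have h2 : 1 / τ ^ (1 / (2 * k) - 1 : ℝ) ≤ 1 := by
    rw [div_le_one (by positivity)]
    apply Real.one_le_rpow_of_pos_of_le_one_of_nonpos hτ (by linarith)
    have : (1 / (2 * k) : ℝ) ≤ 1 := by
      rw [div_le_one (by linarith)]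
      linarith
    linarith
  have h3 : sawtoothConst * (τ ^ (1 / k - 1 : ℝ) * R ^ (3 / 4 : ℝ) + R ^ (1 / 2 : ℝ)) /
      (1 / (2 ^ k * k) * τ ^ (1 / (2 * k) - 1 : ℝ)) = sawtoothConst * (2 ^ k * k) *
        ((τ ^ (1 / k - 1 : ℝ) / τ ^ (1 / (2 * k) - 1 : ℝ)) * R ^ (3 / 4 : ℝ) +
          R ^ (1 / 2 : ℝ) * (1 / τ ^ (1 / (2 * k) - 1 : ℝ))) := by
    field_simp
  rw [h3, h1] at hb
  have hK := sawtoothConst_nonneg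
  refine hb.trans ?_
  rw [show 1 - τ - (1 - 2 * τ) = τ by ring]
  have h4 : R ^ (1 / 2 : ℝ) * (1 / τ ^ (1 / (2 * k) - 1 : ℝ)) ≤ R ^ (1 / 2 : ℝ) :=
    mul_le_of_le_one_right (by positivity) h2
  gcongr

end Superellipse

/-! ### The sawtooth sum along the whole superellipse -/

theorem abs_sum_Ioc_le_sum_of_monotone {ψ : ℕ → ℝ} {m : ℕ → ℕ} (hm : Monotone m) (J : ℕ) :
    |∑ n ∈ Finset.Ioc (m 0) (m J), ψ n| ≤
      ∑ j ∈ Finset.range J, |∑ n ∈ Finset.Ioc (m j) (m (j + 1)), ψ n| := by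
  induction J with
  | zero => simp
  | succ J ih =>
    rw [Finset.sum_range_succ, ← Finset.sum_Ioc_consecutive ψ (hm (Nat.zero_le J))
      (hm (Nat.le_succ J))]
    exact (abs_add_le _ _).trans (by gcongr)

theorem abs_sum_Ioc_le_sum_of_antitone {ψ : ℕ → ℝ} {m : ℕ → ℕ} (hm : Antitone m) (J : ℕ) :
    |∑ n ∈ Finset.Ioc (m J) (m 0), ψ n| ≤
      ∑ j ∈ Finset.range J, |∑ n ∈ Finset.Ioc (m (j + 1)) (m j), ψ n| := by
  induction J with
  | zero => simp
  | succ J ih =>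
    rw [Finset.sum_range_succ, ← Finset.sum_Ioc_consecutive ψ (hm (Nat.le_succ J))
      (hm (Nat.zero_le J)), add_comm]
    exact (abs_add_le _ _).trans (by gcongr)

theorem sum_geom_le_pow {r : ℝ} (hr : 2 ≤ r) (J : ℕ) : ∑ j ∈ Finset.range J, r ^ j ≤ r ^ J := by
  induction J with
  | zero => simp
  | succ J ih =>
    rw [Finset.sum_range_succ, pow_succ]
    have : 0 ≤ r ^ J := by positivity
    nlinarith

theorem sum_geom_le_inv {q : ℝ} (h0 : 0 ≤ q) (h1 : q < 1) (J : ℕ) :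
    ∑ j ∈ Finset.range J, q ^ j ≤ (1 - q)⁻¹ :=
  ((summable_geometric_of_lt_one h0 h1).sum_le_tsum _ fun _ _ => by positivity).trans_eq
    (tsum_geometric_of_lt_one h0 h1)

section

variable {k : ℕ}

/-- The use of k ≥ 4 that lets the generic error R^(3/4) be absorbed. -/
theorem three_quarters_le (hk : 4 ≤ k) : (3 / 4 : ℝ) ≤ 1 - 1 / k := by
  have hk4 : (4 : ℝ) ≤ k := by exact_mod_cast hk
  have : (1 / k : ℝ) ≤ 1 / 4 := one_div_le_one_div_of_le (by norm_num) hk4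
  linarith

theorem natCast_le_rpow_of_two_pow_le (hk : 4 ≤ k) {R : ℝ} (hR : 1 < R) (J : ℕ)
    (hJ : (2 : ℝ) ^ J ≤ R ^ (1 / k : ℝ)) : (J : ℝ) ≤ R ^ (1 - 1 / k : ℝ) := by
  have h1 : (J : ℝ) ≤ 2 ^ J := by exact_mod_cast Nat.lt_two_pow_self.le
  refine h1.trans (hJ.trans (Real.rpow_le_rpow_of_exponent_le hR.le ?_))
  have := three_quarters_le hk
  linarith

theorem sum_dyadic_le (J : ℕ) : ∑ j ∈ Finset.range J, (1 / 4 : ℝ) * (1 / 2) ^ j ≤ 1 := by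
  rw [← Finset.mul_sum]
  have := sum_geom_le_inv (q := 1 / 2) (by norm_num) (by norm_num) J
  norm_num at this ⊢
  linarith

theorem dyadic_le (j : ℕ) : (1 / 4 : ℝ) * (1 / 2) ^ j ≤ 1 / 4 :=
  mul_le_of_le_one_right (by norm_num) (pow_le_one₀ (by norm_num) (by norm_num))

/-- The powers of τ grow geometrically with ratio 2^((k-2)/2) ≥ 2, so the smallest scale dominates.
Since 2^J ≤ R^(1/k), it contributes O(R^(1/2 + (k-2)/(2k))) = O(R^(1-1/k)). -/
theorem exists_abs_sum_low_le (hk : 4 ≤ k) : ∃ C : ℝ, 0 ≤ C ∧ ∀ R : ℝ, 1 < R → ∀ J : ℕ,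
    (2 : ℝ) ^ J ≤ R ^ (1 / k : ℝ) →
    |∑ n ∈ Finset.Ioc ⌊R * ((1 / 2) * (1 / 2) ^ J)⌋₊ ⌊R * (1 / 2)⌋₊,
      sawtooth (R * superellipse k (n / R))| ≤ C * R ^ (1 - 1 / k : ℝ) := by
  have hK := sawtoothConst_nonneg
  refine ⟨1 + sawtoothConst * (2 ^ k + (1 / 4 : ℝ) ^ (-((k - 2) / 2) : ℝ)) + 2, by positivity, ?_⟩
  intro R hR J hJ
  have hR0 : 0 < R := by linarith
  have hk4 : (4 : ℝ) ≤ k := by exact_mod_cast hk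
  have hm : Antitone fun j : ℕ => ⌊R * ((1 / 2) * (1 / 2) ^ j)⌋₊ := by
    intro i j hij
    have : (1 / 2 : ℝ) ^ j ≤ (1 / 2) ^ i := pow_le_pow_of_le_one (by norm_num) (by norm_num) hij
    exact Nat.floor_le_floor (by gcongr)
  have h1 := abs_sum_Ioc_le_sum_of_antitone (ψ := fun n => sawtooth (R * superellipse k (n / R))) hm J
  simp only [pow_zero, mul_one] at h1
  have hJ1 : (J : ℝ) ≤ R ^ (1 - 1 / k : ℝ) := natCast_le_rpow_of_two_pow_le hk hR J hJ
  have h34 : R ^ (3 / 4 : ℝ) ≤ R ^ (1 - 1 / k : ℝ) :=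
    Real.rpow_le_rpow_of_exponent_le hR.le (three_quarters_le hk)
  set e : ℝ := (k - 2) / 2 with he
  have he1 : 1 ≤ e := by
    rw [he]
    linarith
  set r : ℝ := 2 ^ e with hr
  have hr2 : 2 ≤ r := by
    rw [hr]
    nth_rewrite 1 [← Real.rpow_one 2]
    exact Real.rpow_le_rpow_of_exponent_le one_le_two he1
  have hτ : ∀ j : ℕ, ((1 / 4 : ℝ) * (1 / 2) ^ j) ^ (-e) = (1 / 4 : ℝ) ^ (-e) * r ^ j := by
    intro j
    rw [Real.mul_rpow (by norm_num) (by positivity), hr, ← Real.rpow_natCast, ← Real.rpow_natCast,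
      ← Real.rpow_mul (by norm_num), ← Real.rpow_mul (by norm_num), one_div 2,
      Real.inv_rpow (by norm_num), ← Real.rpow_neg (by norm_num)]
    congr 2
    ring
  have hterm : ∀ j : ℕ, |∑ n ∈ Finset.Ioc ⌊R * ((1 / 2) * (1 / 2) ^ (j + 1))⌋₊
      ⌊R * ((1 / 2) * (1 / 2) ^ j)⌋₊, sawtooth (R * superellipse k (n / R))| ≤
      (1 + sawtoothConst * 2 ^ k) * R ^ (3 / 4 : ℝ) * ((1 / 4 : ℝ) * (1 / 2) ^ j) +
        sawtoothConst * (R ^ (1 / 2 : ℝ) * (1 / 4 : ℝ) ^ (-e)) * r ^ j + 2 := by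
    intro j
    have h2 := abs_sum_sawtooth_superellipse_low_le hk (τ := (1 / 4 : ℝ) * (1 / 2) ^ j)
      (by positivity) (dyadic_le j) hR
    rw [hτ] at h2
    rw [show (1 / 2 : ℝ) * (1 / 2) ^ (j + 1) = (1 / 4 : ℝ) * (1 / 2) ^ j by ring,
      show (1 / 2 : ℝ) * (1 / 2) ^ j = 2 * ((1 / 4 : ℝ) * (1 / 2) ^ j) by ring]
    refine h2.trans (le_of_eq ?_)
    ring
  refine h1.trans ((Finset.sum_le_sum fun j _ => hterm j).trans ?_)
  rw [Finset.sum_add_distrib, Finset.sum_add_distrib, Finset.sum_const, Finset.card_range,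
    nsmul_eq_mul]
  have hrJ : R ^ (1 / 2 : ℝ) * r ^ J ≤ R ^ (1 - 1 / k : ℝ) := by
    have h3 : r ^ J ≤ R ^ (1 / k * e : ℝ) := by
      rw [hr, ← Real.rpow_natCast, ← Real.rpow_mul (by norm_num), mul_comm e,
        Real.rpow_mul (by norm_num), Real.rpow_natCast, Real.rpow_mul hR0.le]
      exact Real.rpow_le_rpow (by positivity) hJ (by linarith)
    calc R ^ (1 / 2 : ℝ) * r ^ J ≤ R ^ (1 / 2 : ℝ) * R ^ (1 / k * e : ℝ) := by gcongr
      _ = R ^ (1 - 1 / k : ℝ) := by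
        rw [← Real.rpow_add hR0, he]
        congr 1
        field_simp
        ring
  have hS := sum_geom_le_pow hr2 J
  have e1 : (1 + sawtoothConst * 2 ^ k) * R ^ (3 / 4 : ℝ) *
      ∑ j ∈ Finset.range J, ((1 / 4 : ℝ) * (1 / 2) ^ j) ≤
      (1 + sawtoothConst * 2 ^ k) * R ^ (1 - 1 / k : ℝ) := by
    calc _ ≤ (1 + sawtoothConst * 2 ^ k) * R ^ (3 / 4 : ℝ) * 1 :=
          mul_le_mul_of_nonneg_left (sum_dyadic_le J) (by positivity)
      _ ≤ _ := by
          rw [mul_one]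
          gcongr
  have e2 : sawtoothConst * (R ^ (1 / 2 : ℝ) * (1 / 4 : ℝ) ^ (-e)) * ∑ j ∈ Finset.range J, r ^ j ≤
      sawtoothConst * (1 / 4 : ℝ) ^ (-e) * R ^ (1 - 1 / k : ℝ) := by
    calc _ ≤ sawtoothConst * (R ^ (1 / 2 : ℝ) * (1 / 4 : ℝ) ^ (-e)) * r ^ J := by gcongr
      _ = sawtoothConst * (1 / 4 : ℝ) ^ (-e) * (R ^ (1 / 2 : ℝ) * r ^ J) := by ring
      _ ≤ _ := by gcongr
  rw [Finset.mul_sum] at e1 e2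
  linarith

/-- The powers τ^(1/(2k)) form a convergent geometric series. The term R^(1/2) occurs J ≤ R^(1/k)
times, and 1/2 + 1/k ≤ 1 - 1/k. -/
theorem exists_abs_sum_high_le (hk : 4 ≤ k) : ∃ C : ℝ, 0 ≤ C ∧ ∀ R : ℝ, 1 < R → ∀ J : ℕ,
    (2 : ℝ) ^ J ≤ R ^ (1 / k : ℝ) →
    |∑ n ∈ Finset.Ioc ⌊R * (1 / 2)⌋₊ ⌊R * (1 - (1 / 2) * (1 / 2) ^ J)⌋₊,
      sawtooth (R * superellipse k (n / R))| ≤ C * R ^ (1 - 1 / k : ℝ) := by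
  have hK := sawtoothConst_nonneg
  have hk4 : (4 : ℝ) ≤ k := by exact_mod_cast hk
  set q : ℝ := (1 / 2) ^ (1 / (2 * k) : ℝ) with hq
  have hq0 : 0 ≤ q := by positivity
  have hq1 : q < 1 := Real.rpow_lt_one (by norm_num) (by norm_num) (by positivity)
  have hq2 : 0 < 1 - q := by linarith
  refine ⟨1 + sawtoothConst * (2 ^ k * k) * ((1 - q)⁻¹ + 1) + 2, by positivity, ?_⟩
  intro R hR J hJ
  have hR0 : 0 < R := by linarith
  have hm : Monotone fun j : ℕ => ⌊R * (1 - (1 / 2) * (1 / 2) ^ j)⌋₊ := by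
    intro i j hij
    have : (1 / 2 : ℝ) ^ j ≤ (1 / 2) ^ i := pow_le_pow_of_le_one (by norm_num) (by norm_num) hij
    exact Nat.floor_le_floor (by gcongr)
  have h1 := abs_sum_Ioc_le_sum_of_monotone (ψ := fun n => sawtooth (R * superellipse k (n / R))) hm J
  simp only [pow_zero, mul_one] at h1
  rw [show (1 - 1 / 2 : ℝ) = 1 / 2 by norm_num] at h1
  have hJ1 : (J : ℝ) ≤ R ^ (1 - 1 / k : ℝ) := natCast_le_rpow_of_two_pow_le hk hR J hJ
  have h34 : R ^ (3 / 4 : ℝ) ≤ R ^ (1 - 1 / k : ℝ) :=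
    Real.rpow_le_rpow_of_exponent_le hR.le (three_quarters_le hk)
  have hτ : ∀ j : ℕ, ((1 / 4 : ℝ) * (1 / 2) ^ j) ^ (1 / (2 * k) : ℝ) ≤ q ^ j := by
    intro j
    have h2 : q ^ j = ((1 / 2 : ℝ) ^ j) ^ (1 / (2 * k) : ℝ) := by
      rw [hq, ← Real.rpow_natCast, ← Real.rpow_natCast, ← Real.rpow_mul (by norm_num),
        ← Real.rpow_mul (by norm_num), mul_comm]
    rw [h2]
    apply Real.rpow_le_rpow (by positivity) _ (by positivity)
    exact mul_le_of_le_one_left (by positivity) (by norm_num)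
  have hterm : ∀ j : ℕ, |∑ n ∈ Finset.Ioc ⌊R * (1 - (1 / 2) * (1 / 2) ^ j)⌋₊
      ⌊R * (1 - (1 / 2) * (1 / 2) ^ (j + 1))⌋₊, sawtooth (R * superellipse k (n / R))| ≤
      R ^ (3 / 4 : ℝ) * ((1 / 4 : ℝ) * (1 / 2) ^ j) +
        sawtoothConst * (2 ^ k * k) * R ^ (3 / 4 : ℝ) * q ^ j +
        (sawtoothConst * (2 ^ k * k) * R ^ (1 / 2 : ℝ) + 2) := by
    intro j
    have h2 := abs_sum_sawtooth_superellipse_high_le hk (τ := (1 / 4 : ℝ) * (1 / 2) ^ j)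
      (by positivity) (dyadic_le j) hR
    rw [show (1 / 2 : ℝ) * (1 / 2) ^ (j + 1) = (1 / 4 : ℝ) * (1 / 2) ^ j by ring,
      show (1 / 2 : ℝ) * (1 / 2) ^ j = 2 * ((1 / 4 : ℝ) * (1 / 2) ^ j) by ring]
    refine h2.trans ?_
    have h3 : sawtoothConst * (2 ^ k * k) * R ^ (3 / 4 : ℝ) *
        ((1 / 4 : ℝ) * (1 / 2) ^ j) ^ (1 / (2 * k) : ℝ) ≤
        sawtoothConst * (2 ^ k * k) * R ^ (3 / 4 : ℝ) * q ^ j :=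
      mul_le_mul_of_nonneg_left (hτ j) (by positivity)
    linarith
  refine h1.trans ((Finset.sum_le_sum fun j _ => hterm j).trans ?_)
  rw [Finset.sum_add_distrib, Finset.sum_add_distrib, Finset.sum_const, Finset.card_range,
    nsmul_eq_mul]
  have hS := sum_geom_le_inv hq0 hq1 J
  have e1 : R ^ (3 / 4 : ℝ) * ∑ j ∈ Finset.range J, ((1 / 4 : ℝ) * (1 / 2) ^ j) ≤
      R ^ (1 - 1 / k : ℝ) := by
    calc _ ≤ R ^ (3 / 4 : ℝ) * 1 := mul_le_mul_of_nonneg_left (sum_dyadic_le J) (by positivity)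
      _ ≤ _ := by rwa [mul_one]
  have e2 : sawtoothConst * (2 ^ k * k) * R ^ (3 / 4 : ℝ) * ∑ j ∈ Finset.range J, q ^ j ≤
      sawtoothConst * (2 ^ k * k) * R ^ (1 - 1 / k : ℝ) * (1 - q)⁻¹ := by gcongr
  have e3 : J * R ^ (1 / 2 : ℝ) ≤ R ^ (1 - 1 / k : ℝ) := by
    calc J * R ^ (1 / 2 : ℝ) ≤ R ^ (1 / k : ℝ) * R ^ (1 / 2 : ℝ) := by
          have : (J : ℝ) ≤ 2 ^ J := by exact_mod_cast Nat.lt_two_pow_self.le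
          have := this.trans hJ
          gcongr
      _ = R ^ (1 / k + 1 / 2 : ℝ) := (Real.rpow_add hR0 _ _).symm
      _ ≤ _ := by
          apply Real.rpow_le_rpow_of_exponent_le hR.le
          have := three_quarters_le hk
          linarith
  have e4 : J * (sawtoothConst * (2 ^ k * k) * R ^ (1 / 2 : ℝ) + 2) ≤
      sawtoothConst * (2 ^ k * k) * R ^ (1 - 1 / k : ℝ) + 2 * R ^ (1 - 1 / k : ℝ) := by
    calc _ = sawtoothConst * (2 ^ k * k) * (J * R ^ (1 / 2 : ℝ)) + 2 * J := by ring
      _ ≤ _ := by gcongr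
  rw [Finset.mul_sum] at e1 e2
  linarith

/-- The sawtooth sum along the superellipse `y ^ k + z ^ k = R ^ k`. -/
theorem exists_abs_sum_sawtooth_superellipse_le (hk : 4 ≤ k) : ∃ C : ℝ, 0 ≤ C ∧ ∀ R : ℝ, 1 ≤ R →
    |∑ n ∈ Finset.Ioc 0 ⌊R⌋₊, sawtooth (R * superellipse k (n / R))| ≤
      C * R ^ (1 - 1 / k : ℝ) := by
  obtain ⟨C₁, hC₁, hlow⟩ := exists_abs_sum_low_le hk
  obtain ⟨C₂, hC₂, hhigh⟩ := exists_abs_sum_high_le hk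
  have hk4 : (4 : ℝ) ≤ k := by exact_mod_cast hk
  refine ⟨1 + C₁ + C₂ + 2, by positivity, ?_⟩
  intro R hR1
  rcases hR1.eq_or_lt with rfl | hR
  · refine (abs_sum_sawtooth_le_card _ _).trans ?_
    simp
    linarith
  have hR0 : 0 < R := by linarith
  have hone : 1 ≤ R ^ (1 - 1 / k : ℝ) :=
    Real.one_le_rpow hR1 (by have := three_quarters_le hk; linarith)
  -- The largest J with 2^J ≤ R^(1/k). Each of the two uncut ends then has at most R^(1-1/k) + 1
  -- terms and is bounded trivially.
  obtain ⟨J, hJ, hJ'⟩ := exists_nat_pow_near (x := R ^ (1 / k : ℝ)) (y := 2)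
    (Real.one_le_rpow hR1 (by positivity)) one_lt_two
  have hc : R * ((1 / 2) * (1 / 2) ^ J) ≤ R ^ (1 - 1 / k : ℝ) := by
    rw [Real.rpow_sub hR0, Real.rpow_one, le_div_iff₀ (by positivity)]
    rw [mul_assoc]
    apply mul_le_of_le_one_right hR0.le
    have : (1 / 2 : ℝ) * (1 / 2) ^ J = 1 / 2 ^ (J + 1) := by
      rw [pow_succ, one_div_pow]
      field_simp
    rw [this, one_div_mul_eq_div, div_le_one (by positivity)]
    exact hJ'.le
  set m₁ := ⌊R * ((1 / 2) * (1 / 2) ^ J)⌋₊ with hm₁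
  set m₂ := ⌊R * (1 / 2)⌋₊ with hm₂
  set m₃ := ⌊R * (1 - (1 / 2) * (1 / 2) ^ J)⌋₊ with hm₃
  have hpow : (1 / 2 : ℝ) ^ J ≤ 1 := pow_le_one₀ (by norm_num) (by norm_num)
  have h12 : m₁ ≤ m₂ := Nat.floor_le_floor (by gcongr; linarith)
  have h23 : m₂ ≤ m₃ := Nat.floor_le_floor (by gcongr; linarith)
  have h34 : m₃ ≤ ⌊R⌋₊ := Nat.floor_le_floor (by
    apply mul_le_of_le_one_right hR0.le
    have : 0 < (1 / 2 : ℝ) ^ J := by positivity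
    linarith)
  rw [← Finset.sum_Ioc_consecutive _ (Nat.zero_le m₁) (h12.trans (h23.trans h34)),
    ← Finset.sum_Ioc_consecutive _ h12 (h23.trans h34), ← Finset.sum_Ioc_consecutive _ h23 h34]
  have b1 := abs_sum_sawtooth_le_card (fun n : ℕ => R * superellipse k (n / R)) (Finset.Ioc 0 m₁)
  have b2 := hlow R hR J hJ
  have b3 := hhigh R hR J hJ
  have b4 := abs_sum_sawtooth_le_card (fun n : ℕ => R * superellipse k (n / R))
    (Finset.Ioc m₃ ⌊R⌋₊)
  rw [Nat.card_Ioc, Nat.sub_zero] at b1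
  rw [Nat.card_Ioc, Nat.cast_sub h34] at b4
  have f1 : (m₁ : ℝ) ≤ R * ((1 / 2) * (1 / 2) ^ J) := Nat.floor_le (by positivity)
  have f2 : (⌊R⌋₊ : ℝ) ≤ R := Nat.floor_le hR0.le
  have f3 : R * (1 - (1 / 2) * (1 / 2) ^ J) < m₃ + 1 := Nat.lt_floor_add_one _
  refine (abs_add_le _ _).trans ((add_le_add_right ((abs_add_le _ _).trans
    (add_le_add_right (abs_add_le _ _) _)) _).trans ?_)
  linarith

end

/-! ### Euler–Maclaurin summation without derivatives -/

section EulerMaclaurin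

theorem integral_affine (A B c : ℝ) : ∫ x in c..c + 1, (A + B * (x - c)) = A + B / 2 := by
  rw [intervalIntegral.integral_comp_sub_right (fun x => A + B * x) c, sub_self,
    add_sub_cancel_left, intervalIntegral.integral_add (by simp)
    (Continuous.intervalIntegrable (by fun_prop) _ _),
    intervalIntegral.integral_const_mul, integral_id]
  simp
  ring

variable {g : ℝ → ℝ} {R : ℝ}

theorem AntitoneOn.intervalIntegrable_of_mem_Icc (hg : AntitoneOn g (Set.Icc 0 R)) {a b : ℝ}
    (ha : 0 ≤ a) (hab : a ≤ b) (hb : b ≤ R) : IntervalIntegrable g MeasureTheory.volume a b := by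
  apply AntitoneOn.intervalIntegrable
  rw [Set.uIcc_of_le hab]
  exact hg.mono (Set.Icc_subset_Icc ha hb)

theorem AntitoneOn.integral_mem_Icc (hg : AntitoneOn g (Set.Icc 0 R)) {a b : ℝ}
    (ha : 0 ≤ a) (hab : a ≤ b) (hb : b ≤ R) :
    (b - a) * g b ≤ ∫ x in a..b, g x ∧ ∫ x in a..b, g x ≤ (b - a) * g a := by
  have hi := hg.intervalIntegrable_of_mem_Icc ha hab hb
  constructor
  · have := intervalIntegral.integral_mono_on hab (intervalIntegrable_const (c := g b)) hi
      fun x hx => hg ⟨ha.trans hx.1, hx.2.trans hb⟩ ⟨ha.trans hab, hb⟩ hx.2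
    simpa using this
  · have := intervalIntegral.integral_mono_on hab hi (intervalIntegrable_const (c := g a))
      fun x hx => hg ⟨ha, hab.trans hb⟩ ⟨ha.trans hx.1, hx.2.trans hb⟩ hx.1
    simpa using this

theorem AntitoneOn.integral_succ (hg : AntitoneOn g (Set.Icc 0 R)) {m : ℕ} (hm : (m : ℝ) + 1 ≤ R) :
    ∫ x in (0 : ℝ)..(m + 1 : ℕ), g x = (∫ x in (0 : ℝ)..m, g x) + ∫ x in (m : ℝ)..m + 1, g x := by
  push_cast
  have h0 : (0 : ℝ) ≤ m := Nat.cast_nonneg m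
  exact (intervalIntegral.integral_add_adjacent_intervals
    (hg.intervalIntegrable_of_mem_Icc le_rfl h0 (by linarith))
    (hg.intervalIntegrable_of_mem_Icc h0 (by linarith) hm)).symm

theorem sum_Ioc_succ (g : ℝ → ℝ) (m : ℕ) :
    ∑ n ∈ Finset.Ioc 0 (m + 1), g n = ∑ n ∈ Finset.Ioc 0 m, g n + g (m + 1) := by
  rw [Finset.sum_Ioc_succ_top (Nat.zero_le m)]
  push_cast
  rfl

theorem AntitoneOn.abs_sum_sub_integral_le (hg : AntitoneOn g (Set.Icc 0 R)) (hR : 0 ≤ R)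
    (hpos : ∀ y ∈ Set.Icc 0 R, 0 ≤ g y) :
    |∑ n ∈ Finset.Ioc 0 ⌊R⌋₊, g n - ∫ y in (0 : ℝ)..R, g y| ≤ g 0 := by
  have key : ∀ m : ℕ, (m : ℝ) ≤ R → 0 ≤ (∫ x in (0 : ℝ)..m, g x) - ∑ n ∈ Finset.Ioc 0 m, g n ∧
      (∫ x in (0 : ℝ)..m, g x) - ∑ n ∈ Finset.Ioc 0 m, g n ≤ g 0 - g m := by
    intro m
    induction m with
    | zero => simp
    | succ m ih =>
      intro hm
      push_cast at hm
      have h1 := ih (by linarith)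
      have h2 := hg.integral_mem_Icc (Nat.cast_nonneg m) (show (m : ℝ) ≤ m + 1 by linarith) hm
      rw [hg.integral_succ hm, sum_Ioc_succ]
      push_cast
      constructor <;> linarith [h1.1, h1.2, h2.1, h2.2]
  have hN : (⌊R⌋₊ : ℝ) ≤ R := Nat.floor_le hR
  have hN' : R < ⌊R⌋₊ + 1 := Nat.lt_floor_add_one R
  have h0 : (0 : ℝ) ≤ ⌊R⌋₊ := Nat.cast_nonneg _
  have h1 := key _ hN
  have h2 := hg.integral_mem_Icc h0 hN le_rfl
  have h3 := intervalIntegral.integral_add_adjacent_intervals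
    (hg.intervalIntegrable_of_mem_Icc le_rfl h0 hN) (hg.intervalIntegrable_of_mem_Icc h0 hN le_rfl)
  have h4 := hpos R ⟨hR, le_rfl⟩
  have h5 := hpos _ ⟨h0, hN⟩
  have h6 : 0 ≤ (R - ⌊R⌋₊) * g R := mul_nonneg (by linarith) h4
  have h7 : (R - ⌊R⌋₊) * g ⌊R⌋₊ ≤ 1 * g ⌊R⌋₊ := mul_le_mul_of_nonneg_right (by linarith) h5
  rw [← h3, abs_le]
  constructor <;> linarith [h1.1, h1.2, h2.1, h2.2]

/-- First-order Euler–Maclaurin summation for concave decreasing functions. -/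
theorem ConcaveOn.abs_sum_sub_integral_add_le (hc : ConcaveOn ℝ (Set.Icc 0 R) g)
    (hg : AntitoneOn g (Set.Icc 0 R)) (hR : 1 ≤ R) (hpos : ∀ y ∈ Set.Icc 0 R, 0 ≤ g y) :
    |∑ n ∈ Finset.Ioc 0 ⌊R⌋₊, g n - (∫ y in (0 : ℝ)..R, g y) + g 0 / 2| ≤
      2 * g (⌊R⌋₊ - 1) := by
  have hlin : ∀ A B c : ℝ, IntervalIntegrable (fun x => A + B * (x - c)) MeasureTheory.volume
      c (c + 1) := fun A B c => by
    apply Continuous.intervalIntegrable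
    fun_prop
  -- A concave graph lies above its chord.
  have hlow : ∀ m : ℕ, (m : ℝ) + 1 ≤ R → (g m + g (m + 1)) / 2 ≤ ∫ x in (m : ℝ)..m + 1, g x := by
    intro m hm
    have h0 : (0 : ℝ) ≤ m := Nat.cast_nonneg m
    have h1 := intervalIntegral.integral_mono_on (show (m : ℝ) ≤ m + 1 by linarith)
      (hlin (g m) (g (m + 1) - g m) m)
      (hg.intervalIntegrable_of_mem_Icc h0 (by linarith) hm) (by
        intro x hx
        have h2 := hc.2 (show (m : ℝ) ∈ Set.Icc 0 R from ⟨h0, by linarith⟩)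
          (show (m : ℝ) + 1 ∈ Set.Icc 0 R from ⟨by linarith, hm⟩)
          (show 0 ≤ 1 - (x - m) by linarith [hx.2]) (show 0 ≤ x - m by linarith [hx.1]) (by ring)
        simp only [smul_eq_mul] at h2
        rw [show (1 - (x - m)) * m + (x - m) * (m + 1) = x by ring] at h2
        linarith)
    rw [integral_affine] at h1
    linarith
  -- It lies below the chord of the previous unit interval, prolonged.
  have hupp : ∀ m : ℕ, (m : ℝ) + 2 ≤ R → ∫ x in (m + 1 : ℝ)..m + 1 + 1, g x ≤
      g (m + 1) + (g (m + 1) - g m) / 2 := by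
    intro m hm
    have h0 : (0 : ℝ) ≤ m := Nat.cast_nonneg m
    have h1 := intervalIntegral.integral_mono_on (show (m + 1 : ℝ) ≤ m + 1 + 1 by linarith)
      (hg.intervalIntegrable_of_mem_Icc (by linarith) (by linarith) (by linarith))
      (hlin (g (m + 1)) (g (m + 1) - g m) (m + 1)) (by
        intro x hx
        rcases hx.1.eq_or_lt with h | h
        · rw [← h]
          simp
        · have h2 := hc.slope_anti_adjacent (x := (m : ℝ)) (y := m + 1) (z := x)
            ⟨h0, by linarith⟩ ⟨by linarith, by linarith [hx.2]⟩ (by linarith) h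
          rw [add_sub_cancel_left, div_one, div_le_iff₀ (by linarith)] at h2
          linarith)
    rwa [integral_affine] at h1
  -- The trapezoidal error is nonnegative, and the two bounds carry the upper estimate from `m` to
  -- `m + 1`. No derivative is used, so a vertical tangent at `R` is harmless.
  have key : ∀ m : ℕ, (m : ℝ) + 1 ≤ R →
      0 ≤ (∫ x in (0 : ℝ)..(m + 1 : ℕ), g x) - ∑ n ∈ Finset.Ioc 0 (m + 1), g n - g 0 / 2 +
        g (m + 1) / 2 ∧
      (∫ x in (0 : ℝ)..(m + 1 : ℕ), g x) - ∑ n ∈ Finset.Ioc 0 (m + 1), g n - g 0 / 2 +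
        g (m + 1) / 2 ≤ (g m - g (m + 1)) / 2 := by
    intro m
    induction m with
    | zero =>
      intro hm
      have h1 := hlow 0 hm
      have h2 := (hg.integral_mem_Icc le_rfl zero_le_one hR).2
      simp at h1 h2 ⊢
      constructor <;> linarith
    | succ m ih =>
      intro hm
      push_cast at hm
      have h1 := ih (by linarith)
      have h2 := hlow (m + 1) (by push_cast; linarith)
      have h3 := hupp m (by linarith)
      rw [hg.integral_succ (by push_cast; linarith), sum_Ioc_succ]
      push_cast at h1 h2 h3 ⊢
      constructor <;> linarith [h1.1, h1.2]
  obtain ⟨m, hm⟩ : ∃ m, ⌊R⌋₊ = m + 1 :=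
    ⟨⌊R⌋₊ - 1, by have := (Nat.one_le_floor_iff R).2 hR; omega⟩
  have hN : (⌊R⌋₊ : ℝ) ≤ R := Nat.floor_le (by linarith)
  have hN' : R < ⌊R⌋₊ + 1 := Nat.lt_floor_add_one R
  rw [hm] at hN hN' ⊢
  have h0 : (0 : ℝ) ≤ (m + 1 : ℕ) := Nat.cast_nonneg _
  have h1 := key m (by push_cast at hN; linarith)
  have h2 := hg.integral_mem_Icc h0 hN le_rfl
  have h3 := intervalIntegral.integral_add_adjacent_intervals
    (hg.intervalIntegrable_of_mem_Icc le_rfl h0 hN) (hg.intervalIntegrable_of_mem_Icc h0 hN le_rfl)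
  have h4 := hpos R ⟨by linarith, le_rfl⟩
  have h5 := hpos _ ⟨h0, hN⟩
  have h6 : 0 ≤ (R - (m + 1 : ℕ)) * g R := mul_nonneg (by linarith) h4
  have h7 : (R - (m + 1 : ℕ)) * g (m + 1 : ℕ) ≤ 1 * g (m + 1 : ℕ) :=
    mul_le_mul_of_nonneg_right (by linarith) h5
  have h8 : g (m + 1 : ℕ) ≤ g m := hg ⟨Nat.cast_nonneg m, by push_cast at hN; linarith⟩ ⟨h0, hN⟩
    (by push_cast; linarith)
  rw [← h3, abs_le]
  push_cast at *
  rw [add_sub_cancel_right]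
  constructor <;> linarith [h1.1, h1.2, h2.1, h2.2]

end EulerMaclaurin

/-! ### Beta integrals -/

section Beta

theorem integral_rpow_mul_one_sub_rpow {a b : ℝ} (ha : 0 < a) (hb : 0 < b) :
    ∫ x in (0 : ℝ)..1, x ^ (a - 1) * (1 - x) ^ (b - 1) =
      Real.Gamma a * Real.Gamma b / Real.Gamma (a + b) := by
  have h := ProbabilityTheory.beta_eq_betaIntegralReal a b ha hb
  rw [ProbabilityTheory.beta] at h
  have h2 : Complex.betaIntegral a b =
      ((∫ x in (0 : ℝ)..1, x ^ (a - 1) * (1 - x) ^ (b - 1) : ℝ) : ℂ) := by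
    rw [Complex.betaIntegral, ← intervalIntegral.integral_ofReal]
    refine intervalIntegral.integral_congr fun x hx => ?_
    rw [Set.uIcc_of_le zero_le_one] at hx
    rw [Complex.ofReal_mul, Complex.ofReal_cpow hx.1, Complex.ofReal_cpow (by linarith [hx.2])]
    push_cast
    rfl
  rw [h, h2, Complex.ofReal_re]

/-- The substitution u = x^(1/k) gives 1/k times the Beta integral at (1/k, α + 1). The indicator of
x ≤ 1 lets the half-line substitution serve on [0, 1]. -/
theorem integral_one_sub_pow_rpow {k : ℕ} (hk : k ≠ 0) {α : ℝ} (hα : 0 ≤ α) :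
    ∫ u in (0 : ℝ)..1, (1 - u ^ k) ^ α =
      Real.Gamma ((k + 1) / k) * Real.Gamma (α + 1) / Real.Gamma (α + 1 + 1 / k) := by
  have hk0 : (0 : ℝ) < k := by exact_mod_cast Nat.pos_of_ne_zero hk
  have hp : (0 : ℝ) < 1 / k := by positivity
  have h1 := MeasureTheory.integral_comp_rpow_Ioi_of_pos
    (g := Set.indicator (Set.Iic 1) fun u : ℝ => (1 - u ^ k) ^ α) hp
  have h2 : ∫ u in Set.Ioi (0 : ℝ), Set.indicator (Set.Iic 1) (fun u : ℝ => (1 - u ^ k) ^ α) u =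
      ∫ u in (0 : ℝ)..1, (1 - u ^ k) ^ α := by
    rw [MeasureTheory.setIntegral_indicator measurableSet_Iic, Set.Ioi_inter_Iic,
      intervalIntegral.integral_of_le zero_le_one]
  have h3 : ∫ x in Set.Ioi (0 : ℝ), ((1 / k : ℝ) * x ^ (1 / k - 1 : ℝ)) •
      Set.indicator (Set.Iic 1) (fun u : ℝ => (1 - u ^ k) ^ α) (x ^ (1 / k : ℝ)) =
      ∫ x in Set.Ioi (0 : ℝ), Set.indicator (Set.Iic 1)
        (fun x : ℝ => (1 / k : ℝ) * (x ^ (1 / k - 1 : ℝ) * (1 - x) ^ (α + 1 - 1))) x := by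
    refine MeasureTheory.setIntegral_congr_fun measurableSet_Ioi fun x hx => ?_
    have hx0 : 0 < x := hx
    have h4 : (x ^ (1 / k : ℝ)) ^ k = x := by
      rw [← Real.rpow_natCast, ← Real.rpow_mul hx0.le, one_div_mul_cancel hk0.ne', Real.rpow_one]
    have h5 : x ^ (1 / k : ℝ) ≤ 1 ↔ x ≤ 1 := by
      have := Real.rpow_le_rpow_iff hx0.le zero_le_one hp
      rwa [Real.one_rpow] at this
    simp only [Set.indicator, Set.mem_Iic, h5, smul_eq_mul]
    split_ifs
    · rw [h4, add_sub_cancel_right, mul_assoc]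
    · rw [mul_zero]
  rw [h3, h2, MeasureTheory.setIntegral_indicator measurableSet_Iic, Set.Ioi_inter_Iic,
    ← intervalIntegral.integral_of_le zero_le_one, intervalIntegral.integral_const_mul,
    integral_rpow_mul_one_sub_rpow hp (by linarith)] at h1
  rw [← h1, show ((k : ℝ) + 1) / k = 1 / k + 1 by field_simp; ring, Real.Gamma_add_one hp.ne',
    show α + 1 + 1 / k = 1 / k + (α + 1) by ring]
  ring

theorem integral_pow_sub_pow_rpow {k : ℕ} (hk : k ≠ 0) {α R : ℝ} (hα : 0 ≤ α) (hR : 0 < R) :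
    ∫ y in (0 : ℝ)..R, (R ^ k - y ^ k) ^ α = R ^ (k * α + 1) *
      (Real.Gamma ((k + 1) / k) * Real.Gamma (α + 1) / Real.Gamma (α + 1 + 1 / k)) := by
  rw [← integral_one_sub_pow_rpow hk hα]
  have h1 := intervalIntegral.integral_comp_mul_left (a := 0) (b := 1)
    (fun y : ℝ => (R ^ k - y ^ k) ^ α) hR.ne'
  rw [mul_zero, mul_one, smul_eq_mul] at h1
  have h2 : ∫ u in (0 : ℝ)..1, (R ^ k - (R * u) ^ k) ^ α =
      R ^ (k * α) * ∫ u in (0 : ℝ)..1, (1 - u ^ k) ^ α := by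
    rw [← intervalIntegral.integral_const_mul]
    refine intervalIntegral.integral_congr fun u hu => ?_
    rw [Set.uIcc_of_le zero_le_one] at hu
    have h3 : 0 ≤ 1 - u ^ k := sub_nonneg.2 (pow_le_one₀ hu.1 hu.2)
    rw [mul_pow, ← mul_one_sub, Real.mul_rpow (by positivity) h3, Real.rpow_mul hR.le,
      Real.rpow_natCast]
  rw [h2] at h1
  rw [Real.rpow_add hR, Real.rpow_one]
  field_simp at h1
  linarith

end Beta

/-! ### Summing the main terms over one variable -/

section MainTerm

variable {k : ℕ}

theorem antitoneOn_pow_sub_pow_rpow {α R : ℝ} (hα : 0 ≤ α) :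
    AntitoneOn (fun y : ℝ => (R ^ k - y ^ k) ^ α) (Set.Icc 0 R) := by
  intro y hy z hz hyz
  have h1 : z ^ k ≤ R ^ k := pow_le_pow_left₀ hz.1 hz.2 k
  have h2 : y ^ k ≤ z ^ k := pow_le_pow_left₀ hy.1 hyz k
  exact Real.rpow_le_rpow (by linarith) (by linarith) hα

/-- A concave increasing power composed with a concave function. Used with α = s/k, this is what
confines the induction to s ≤ k. -/
theorem concaveOn_pow_sub_pow_rpow {α R : ℝ} (hα : 0 ≤ α) (hα1 : α ≤ 1) :
    ConcaveOn ℝ (Set.Icc 0 R) (fun y : ℝ => (R ^ k - y ^ k) ^ α) := by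
  refine ⟨convex_Icc 0 R, ?_⟩
  intro y hy z hz a b ha hb hab
  have hw := convex_Icc 0 R hy hz ha hb hab
  have h1 : y ^ k ≤ R ^ k := pow_le_pow_left₀ hy.1 hy.2 k
  have h2 : z ^ k ≤ R ^ k := pow_le_pow_left₀ hz.1 hz.2 k
  have h3 := (convexOn_pow k).2 (show y ∈ Set.Ici 0 from hy.1) (show z ∈ Set.Ici 0 from hz.1)
    ha hb hab
  have h4 := (Real.concaveOn_rpow hα hα1).2 (show R ^ k - y ^ k ∈ Set.Ici 0 from sub_nonneg.2 h1)
    (show R ^ k - z ^ k ∈ Set.Ici 0 from sub_nonneg.2 h2) ha hb hab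
  refine h4.trans ?_
  simp only [smul_eq_mul] at h3 ⊢
  have h5 : 0 ≤ a * (R ^ k - y ^ k) := mul_nonneg ha (sub_nonneg.2 h1)
  have h6 : 0 ≤ b * (R ^ k - z ^ k) := mul_nonneg hb (sub_nonneg.2 h2)
  refine Real.rpow_le_rpow (by linarith) ?_ hα
  have h7 : a * (R ^ k - y ^ k) + b * (R ^ k - z ^ k) = R ^ k - (a * y ^ k + b * z ^ k) := by
    linear_combination R ^ k * hab
  rw [h7]
  linarith

theorem pow_sub_pow_rpow_nonneg {α R : ℝ} : ∀ y ∈ Set.Icc 0 R, 0 ≤ (R ^ k - y ^ k) ^ α :=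
  fun _ hy => Real.rpow_nonneg (sub_nonneg.2 (pow_le_pow_left₀ hy.1 hy.2 k)) _

theorem pow_sub_pow_le {y R : ℝ} (hy : 0 ≤ y) (hyR : y ≤ R) :
    R ^ k - y ^ k ≤ k * R ^ (k - 1) * (R - y) := by
  have hR : 0 ≤ R := hy.trans hyR
  rw [← geom_sum₂_mul R y k]
  apply mul_le_mul_of_nonneg_right _ (by linarith)
  calc ∑ i ∈ Finset.range k, R ^ i * y ^ (k - 1 - i) ≤ ∑ i ∈ Finset.range k, R ^ (k - 1) := by
        refine Finset.sum_le_sum fun i hi => ?_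
        have : i + (k - 1 - i) = k - 1 := by
          have := Finset.mem_range.1 hi
          omega
        calc R ^ i * y ^ (k - 1 - i) ≤ R ^ i * R ^ (k - 1 - i) := by gcongr
          _ = R ^ (k - 1) := by rw [← pow_add, this]
    _ = k * R ^ (k - 1) := by simp

theorem abs_sum_pow_sub_pow_rpow_sub_le (hk : 1 ≤ k) {α R : ℝ} (hα : 0 ≤ α) (hα1 : α ≤ 1)
    (hR : 1 ≤ R) :
    |∑ n ∈ Finset.Ioc 0 ⌊R⌋₊, (R ^ k - (n : ℝ) ^ k) ^ α -
      R ^ (k * α + 1) * (Real.Gamma ((k + 1) / k) * Real.Gamma (α + 1) /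
        Real.Gamma (α + 1 + 1 / k)) + R ^ (k * α) / 2| ≤ 4 * k * R ^ ((k - 1) * α) := by
  have hR0 : 0 < R := by linarith
  have hk1 : (1 : ℝ) ≤ k := by exact_mod_cast hk
  have h := (concaveOn_pow_sub_pow_rpow (k := k) (R := R) hα hα1).abs_sum_sub_integral_add_le
    (antitoneOn_pow_sub_pow_rpow hα) hR pow_sub_pow_rpow_nonneg
  rw [integral_pow_sub_pow_rpow (by omega) hα hR0, zero_pow (by omega), sub_zero,
    ← Real.rpow_natCast R k, ← Real.rpow_mul hR0.le] at h
  simp_rw [Real.rpow_natCast] at h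
  refine h.trans ?_
  have hN : (⌊R⌋₊ : ℝ) ≤ R := Nat.floor_le hR0.le
  have hN' : R < ⌊R⌋₊ + 1 := Nat.lt_floor_add_one R
  have hN1 : (1 : ℝ) ≤ ⌊R⌋₊ := by exact_mod_cast (Nat.one_le_floor_iff R).2 hR
  have h1 := pow_sub_pow_le (k := k) (y := (⌊R⌋₊ : ℝ) - 1) (R := R) (by linarith) (by linarith)
  have h2 : (0 : ℝ) ≤ R ^ k - ((⌊R⌋₊ : ℝ) - 1) ^ k :=
    sub_nonneg.2 (pow_le_pow_left₀ (by linarith) (by linarith) k)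
  have h3 : R ^ k - ((⌊R⌋₊ : ℝ) - 1) ^ k ≤ (2 * k) * R ^ (k - 1) := by
    refine h1.trans ?_
    have : (k : ℝ) * R ^ (k - 1) * (R - (⌊R⌋₊ - 1)) ≤ k * R ^ (k - 1) * 2 :=
      mul_le_mul_of_nonneg_left (by linarith) (by positivity)
    linarith
  have h4 : (2 * k : ℝ) ^ α ≤ 2 * k := by
    nth_rewrite 2 [← Real.rpow_one (2 * k : ℝ)]
    exact Real.rpow_le_rpow_of_exponent_le (by linarith) hα1
  calc 2 * (R ^ k - ((⌊R⌋₊ : ℝ) - 1) ^ k) ^ α ≤ 2 * ((2 * k) * R ^ (k - 1)) ^ α := by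
        gcongr
    _ = 2 * ((2 * k : ℝ) ^ α * R ^ ((k - 1) * α)) := by
        rw [Real.mul_rpow (by positivity) (by positivity), ← Real.rpow_natCast R,
          ← Real.rpow_mul hR0.le, Nat.cast_sub hk, Nat.cast_one]
    _ ≤ 2 * ((2 * k) * R ^ ((k - 1) * α)) := by gcongr
    _ = _ := by ring

/-- Monotonicity alone is enough for the secondary term, where an error of the size of the largest
summand is admissible. -/
theorem abs_sum_pow_sub_pow_rpow_sub_le' (hk : 1 ≤ k) {α R : ℝ} (hα : 0 ≤ α) (hR : 1 ≤ R) :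
    |∑ n ∈ Finset.Ioc 0 ⌊R⌋₊, (R ^ k - (n : ℝ) ^ k) ^ α -
      R ^ (k * α + 1) * (Real.Gamma ((k + 1) / k) * Real.Gamma (α + 1) /
        Real.Gamma (α + 1 + 1 / k))| ≤ R ^ (k * α) := by
  have hR0 : 0 < R := by linarith
  have h := (antitoneOn_pow_sub_pow_rpow (k := k) (R := R) hα).abs_sum_sub_integral_le
    hR0.le pow_sub_pow_rpow_nonneg
  rw [integral_pow_sub_pow_rpow (by omega) hα hR0, zero_pow (by omega), sub_zero,
    ← Real.rpow_natCast R k, ← Real.rpow_mul hR0.le] at h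
  simp_rw [Real.rpow_natCast] at h
  exact h

theorem powerRepMain_pow (hk : 1 ≤ k) {s : ℕ} {R : ℝ} (hR : 0 < R) :
    powerRepMain k s (R ^ k) =
      Real.Gamma ((k + 1) / k) ^ s / Real.Gamma ((k + s) / k) * R ^ (s : ℝ) -
        s / 2 * (Real.Gamma ((k + 1) / k) ^ (s - 1) / Real.Gamma ((k + s - 1) / k)) *
          R ^ (s - 1 : ℝ) := by
  have hk0 : (k : ℝ) ≠ 0 := by
    have : k ≠ 0 := by omega
    exact_mod_cast this
  rw [powerRepMain, ← Real.rpow_natCast R k, ← Real.rpow_mul hR.le, ← Real.rpow_mul hR.le,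
    mul_div_cancel₀ _ hk0, mul_div_cancel₀ _ hk0]

/-- Summation of the main terms over one variable. -/
theorem exists_abs_sum_powerRepMain_sub_le (hk : 1 ≤ k) {s : ℕ} (hs : 1 ≤ s) (hsk : s ≤ k) :
    ∃ C : ℝ, 0 ≤ C ∧ ∀ R : ℝ, 1 ≤ R →
      |∑ n ∈ Finset.Ioc 0 ⌊R⌋₊, powerRepMain k s (R ^ k - (n : ℝ) ^ k) -
        powerRepMain k (s + 1) (R ^ k)| ≤ C * R ^ (s - 1 / k : ℝ) := by
  have hk1 : (1 : ℝ) ≤ k := by exact_mod_cast hk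
  have hk0 : (k : ℝ) ≠ 0 := by linarith
  have hs1 : (1 : ℝ) ≤ s := by exact_mod_cast hs
  have hsk1 : (s : ℝ) ≤ k := by exact_mod_cast hsk
  set G := Real.Gamma ((k + 1) / k) with hG
  set c := G ^ s / Real.Gamma ((k + s) / k) with hc
  set d := s / 2 * (G ^ (s - 1) / Real.Gamma ((k + s - 1) / k)) with hd
  have hG1 : 0 < Real.Gamma ((k + s) / k) := Real.Gamma_pos_of_pos (by positivity)
  have hG2 : 0 < Real.Gamma ((k + s - 1) / k) :=
    Real.Gamma_pos_of_pos (div_pos (by linarith) (by linarith))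
  have hG0 : 0 < G := Real.Gamma_pos_of_pos (by positivity)
  have hc0 : 0 ≤ c := by positivity
  have hd0 : 0 ≤ d := by positivity
  refine ⟨c * (4 * k) + d, by positivity, ?_⟩
  intro R hR
  have hR0 : 0 < R := by linarith
  have e1 := abs_sum_pow_sub_pow_rpow_sub_le hk (α := s / k) (R := R) (by positivity)
    (by rw [div_le_one (by linarith)]; exact hsk1) hR
  have e2 := abs_sum_pow_sub_pow_rpow_sub_le' hk (α := (s - 1) / k) (R := R)
    (div_nonneg (by linarith) (by linarith)) hR
  rw [mul_div_cancel₀ _ hk0] at e1 e2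
  rw [show (s / k + 1 : ℝ) = (k + s) / k by field_simp; ring,
    show ((k + s) / k + 1 / k : ℝ) = (k + (s + 1 : ℕ)) / k by push_cast; field_simp; ring] at e1
  rw [show ((s - 1) / k + 1 : ℝ) = (k + s - 1) / k by field_simp; ring,
    show ((k + s - 1) / k + 1 / k : ℝ) = (k + s) / k by field_simp; ring,
    sub_add_cancel] at e2
  have hG3 : 0 < Real.Gamma ((k + (s + 1 : ℕ)) / k) := Real.Gamma_pos_of_pos (by positivity)
  have hsum : ∑ n ∈ Finset.Ioc 0 ⌊R⌋₊, powerRepMain k s (R ^ k - (n : ℝ) ^ k) =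
      c * ∑ n ∈ Finset.Ioc 0 ⌊R⌋₊, (R ^ k - (n : ℝ) ^ k) ^ (s / k : ℝ) -
      d * ∑ n ∈ Finset.Ioc 0 ⌊R⌋₊, (R ^ k - (n : ℝ) ^ k) ^ ((s - 1) / k : ℝ) := by
    rw [Finset.mul_sum, Finset.mul_sum, ← Finset.sum_sub_distrib]
    rfl
  -- The Gamma quotients telescope. At R^s the boundary term gives 1/2 and the integral of the
  -- secondary term gives s/2, together (s + 1)/2.
  have hmain : powerRepMain k (s + 1) (R ^ k) =
      c * (R ^ (s + 1 : ℝ) * (G * Real.Gamma ((k + s) / k) / Real.Gamma ((k + (s + 1 : ℕ)) / k)) -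
        R ^ (s : ℝ) / 2) -
      d * (R ^ (s : ℝ) * (G * Real.Gamma ((k + s - 1) / k) / Real.Gamma ((k + s) / k))) := by
    rw [powerRepMain_pow hk hR0, hc, hd, Nat.add_sub_cancel,
      show (k + (s + 1 : ℕ) - 1 : ℝ) = k + s by push_cast; ring,
      show ((s + 1 : ℕ) - 1 : ℝ) = s by push_cast; ring]
    obtain ⟨t, rfl⟩ : ∃ t, s = t + 1 := ⟨s - 1, by omega⟩
    rw [Nat.add_sub_cancel, ← hG]
    push_cast at hG1 hG2 hG3 ⊢
    field_simp
    ring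
  rw [hsum, hmain]
  set S₁ := ∑ n ∈ Finset.Ioc 0 ⌊R⌋₊, (R ^ k - (n : ℝ) ^ k) ^ (s / k : ℝ)
  set S₂ := ∑ n ∈ Finset.Ioc 0 ⌊R⌋₊, (R ^ k - (n : ℝ) ^ k) ^ ((s - 1) / k : ℝ)
  set I₁ := R ^ (s + 1 : ℝ) * (G * Real.Gamma ((k + s) / k) / Real.Gamma ((k + (s + 1 : ℕ)) / k))
  set I₂ := R ^ (s : ℝ) * (G * Real.Gamma ((k + s - 1) / k) / Real.Gamma ((k + s) / k))
  have f1 : R ^ ((k - 1) * (s / k) : ℝ) ≤ R ^ (s - 1 / k : ℝ) := by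
    apply Real.rpow_le_rpow_of_exponent_le hR
    have : ((k - 1) * (s / k) : ℝ) = s - s / k := by field_simp
    rw [this]
    have : (1 / k : ℝ) ≤ s / k := by gcongr
    linarith
  have f2 : R ^ (s - 1 : ℝ) ≤ R ^ (s - 1 / k : ℝ) := by
    apply Real.rpow_le_rpow_of_exponent_le hR
    have : (1 / k : ℝ) ≤ 1 := by
      rw [div_le_one (by linarith)]
      exact hk1
    linarith
  have e3 : |c * (S₁ - I₁ + R ^ (s : ℝ) / 2)| ≤ c * (4 * k * R ^ (s - 1 / k : ℝ)) := by
    rw [abs_mul, abs_of_nonneg hc0]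
    exact mul_le_mul_of_nonneg_left (e1.trans (by gcongr)) hc0
  have e4 : |d * (S₂ - I₂)| ≤ d * R ^ (s - 1 / k : ℝ) := by
    rw [abs_mul, abs_of_nonneg hd0]
    exact mul_le_mul_of_nonneg_left (e2.trans f2) hd0
  have e5 : c * S₁ - d * S₂ - (c * (I₁ - R ^ (s : ℝ) / 2) - d * I₂) =
      c * (S₁ - I₁ + R ^ (s : ℝ) / 2) - d * (S₂ - I₂) := by ring
  rw [e5]
  refine (abs_sub _ _).trans ?_
  linarith

end MainTerm

/-! ### Recursion for the counting function -/

section Counting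

variable {k : ℕ}

/-- The number of representations of the integers `0, …, n` as sums of `s` positive `k`-th
powers. -/
noncomputable def powerRepSum (k s n : ℕ) : ℕ := ∑ m ∈ Finset.range (n + 1), powerRep k s m

theorem powerRep_eq_card (hk : k ≠ 0) (s : ℕ) {m n : ℕ} (h : m ≤ n) :
    powerRep k s m = ((Fintype.piFinset fun _ : Fin s => Finset.Icc 1 n).filter
      fun x => ∑ i, x i ^ k = m).card := by
  rw [powerRep, ← Set.ncard_coe_finset]
  congr 1
  ext x
  simp only [Set.mem_ofPred_eq, Finset.coe_filter, Fintype.mem_piFinset, Finset.mem_Icc]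
  constructor
  · rintro ⟨h1, h2⟩
    refine ⟨fun i => ⟨h1 i, ?_⟩, h2⟩
    calc x i ≤ x i ^ k := Nat.le_self_pow hk _
      _ ≤ ∑ j, x j ^ k :=
          Finset.single_le_sum (f := fun j => x j ^ k) (fun _ _ => Nat.zero_le _)
            (Finset.mem_univ i)
      _ ≤ n := h2.trans_le h
  · rintro ⟨h1, h2⟩
    exact ⟨fun i => (h1 i).1, h2⟩

theorem powerRepSum_eq_card (hk : k ≠ 0) (s : ℕ) {n N : ℕ} (h : n ≤ N) :
    powerRepSum k s n = ((Fintype.piFinset fun _ : Fin s => Finset.Icc 1 N).filter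
      fun x => ∑ i, x i ^ k ≤ n).card := by
  rw [powerRepSum, Finset.card_eq_sum_card_fiberwise (f := fun x => ∑ i, x i ^ k)
    (t := Finset.range (n + 1))]
  · refine Finset.sum_congr rfl fun m hm => ?_
    have hmn : m ≤ n := Nat.lt_succ_iff.1 (Finset.mem_range.1 hm)
    rw [powerRep_eq_card hk s (hmn.trans h), Finset.filter_filter]
    congr 1
    refine Finset.filter_congr fun x _ => ?_
    constructor
    · intro h1
      exact ⟨h1.trans_le hmn, h1⟩
    · exact fun h1 => h1.2
  · intro x hx
    have := (Finset.mem_filter.1 hx).2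
    simp only [Finset.coe_range, Set.mem_Iio]
    omega

/-- The first coordinate of each tuple is split off; one common box for all coordinates makes this a
bijection of finite sets. -/
theorem powerRepSum_succ (hk : k ≠ 0) (s n : ℕ) :
    powerRepSum k (s + 1) n =
      ∑ y ∈ (Finset.Icc 1 n).filter (fun y => y ^ k ≤ n), powerRepSum k s (n - y ^ k) := by
  rw [powerRepSum_eq_card hk (s + 1) le_rfl]
  have h1 : ∀ y ∈ (Finset.Icc 1 n).filter (fun y => y ^ k ≤ n), powerRepSum k s (n - y ^ k) =
      ((Fintype.piFinset fun _ : Fin s => Finset.Icc 1 n).filter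
        fun x => ∑ i, x i ^ k ≤ n - y ^ k).card := fun y _ =>
    powerRepSum_eq_card hk s (Nat.sub_le _ _)
  rw [Finset.sum_congr rfl h1, ← Finset.card_sigma]
  refine Finset.card_bij' (fun x _ => ⟨x 0, Fin.tail x⟩) (fun p _ => Fin.cons p.1 p.2) ?_ ?_ ?_ ?_
  · intro x hx
    simp only [Finset.mem_filter, Fintype.mem_piFinset, Fin.sum_univ_succ] at hx
    simp only [Finset.mem_sigma, Finset.mem_filter, Fintype.mem_piFinset, Fin.tail]
    exact ⟨⟨hx.1 0, by omega⟩, fun i => hx.1 i.succ, by omega⟩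
  · rintro ⟨y, x⟩ hx
    simp only [Finset.mem_sigma, Finset.mem_filter, Fintype.mem_piFinset] at hx
    simp only [Finset.mem_filter, Fintype.mem_piFinset, Fin.sum_univ_succ, Fin.cons_zero,
      Fin.cons_succ]
    refine ⟨fun i => ?_, by omega⟩
    refine Fin.cases ?_ (fun j => ?_) i
    · rw [Fin.cons_zero]
      exact hx.1.1
    · rw [Fin.cons_succ]
      exact hx.2.1 j
  · intro x _
    exact Fin.cons_self_tail x
  · rintro ⟨y, x⟩ _
    simp

theorem powerRepSum_zero_left (hk : k ≠ 0) (n : ℕ) : powerRepSum k 0 n = 1 := by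
  rw [powerRepSum_eq_card hk 0 le_rfl]
  simp

theorem powerRep_zero_right (hk : k ≠ 0) {s : ℕ} (hs : s ≠ 0) : powerRep k s 0 = 0 := by
  obtain ⟨t, rfl⟩ := Nat.exists_eq_succ_of_ne_zero hs
  rw [powerRep_eq_card hk (t + 1) le_rfl]
  simp

theorem sum_Icc_powerRep (hk : k ≠ 0) {s : ℕ} (hs : s ≠ 0) (n : ℕ) :
    ∑ m ∈ Finset.Icc 1 n, powerRep k s m = powerRepSum k s n := by
  refine Finset.sum_subset (fun m hm => ?_) fun m hm hm' => ?_
  · rw [Finset.mem_range, Nat.lt_succ_iff]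
    exact (Finset.mem_Icc.1 hm).2
  · rw [Finset.mem_range] at hm
    rw [Finset.mem_Icc] at hm'
    rw [show m = 0 by omega, powerRep_zero_right hk hs]

theorem powerRepSum_zero_right (hk : k ≠ 0) {s : ℕ} (hs : s ≠ 0) : powerRepSum k s 0 = 0 := by
  rw [← sum_Icc_powerRep hk hs]
  simp

theorem powerRepSum_succ_floor (hk : k ≠ 0) (s : ℕ) {R : ℝ} (hR : 0 ≤ R) :
    powerRepSum k (s + 1) ⌊R ^ k⌋₊ =
      ∑ y ∈ Finset.Ioc 0 ⌊R⌋₊, powerRepSum k s ⌊R ^ k - (y : ℝ) ^ k⌋₊ := by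
  have hmem : ∀ y : ℕ, y ^ k ≤ ⌊R ^ k⌋₊ ↔ y ≤ ⌊R⌋₊ := by
    intro y
    rw [Nat.le_floor_iff (by positivity), Nat.le_floor_iff hR, Nat.cast_pow,
      pow_le_pow_iff_left₀ (Nat.cast_nonneg y) hR hk]
  rw [powerRepSum_succ hk]
  refine Finset.sum_congr ?_ fun y hy => ?_
  · ext y
    simp only [Finset.mem_filter, Finset.mem_Icc, Finset.mem_Ioc, hmem]
    constructor
    · rintro ⟨⟨h1, _⟩, h2⟩
      exact ⟨h1, h2⟩
    · rintro ⟨h1, h2⟩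
      exact ⟨⟨h1, (Nat.le_self_pow hk y).trans ((hmem y).2 h2)⟩, h2⟩
  · rw [← Nat.floor_sub_natCast, Nat.cast_pow]

theorem powerRepSum_one_floor (hk : k ≠ 0) {R : ℝ} (hR : 0 ≤ R) :
    powerRepSum k 1 ⌊R ^ k⌋₊ = ⌊R⌋₊ := by
  rw [powerRepSum_succ_floor hk 0 hR]
  simp [powerRepSum_zero_left hk]

end Counting

/-! ### The case s = 2 and the induction on s -/

section Asymptotics

variable {k : ℕ}

/-- The convention 0^0 = 1 keeps the term -1/2 at R = 0, which is needed for the summand n = R when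
R is an integer. -/
theorem powerRepMain_one (hk : k ≠ 0) {R : ℝ} (hR : 0 ≤ R) :
    powerRepMain k 1 (R ^ k) = R - 1 / 2 := by
  have hk0 : (k : ℝ) ≠ 0 := by exact_mod_cast hk
  have h1 : (R ^ k) ^ ((1 : ℕ) / k : ℝ) = R := by
    rw [← Real.rpow_natCast, ← Real.rpow_mul hR, Nat.cast_one, mul_one_div_cancel hk0,
      Real.rpow_one]
  have hG : Real.Gamma (((k : ℝ) + 1) / k) ≠ 0 := (Real.Gamma_pos_of_pos (by positivity)).ne'
  rw [powerRepMain, h1]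
  simp [hk0, hG]

theorem abs_powerRepMain_le {s : ℕ} (hs : 1 ≤ s) :
    ∃ D : ℝ, 0 ≤ D ∧ ∀ t : ℝ, 0 ≤ t → t ≤ 1 → |powerRepMain k s t| ≤ D := by
  refine ⟨|Real.Gamma (((k : ℝ) + 1) / k) ^ s / Real.Gamma (((k : ℝ) + s) / k)| + |(s : ℝ) / 2 *
      (Real.Gamma (((k : ℝ) + 1) / k) ^ (s - 1) / Real.Gamma (((k : ℝ) + s - 1) / k))|,
    by positivity, ?_⟩
  intro t h0 h1
  have hs1 : (1 : ℝ) ≤ s := by exact_mod_cast hs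
  have hpow : ∀ e : ℝ, 0 ≤ e → |t ^ e| ≤ 1 := fun e he => by
    rw [abs_of_nonneg (by positivity)]
    exact Real.rpow_le_one h0 h1 he
  rw [powerRepMain]
  refine (abs_sub _ _).trans ?_
  rw [abs_mul, abs_mul _ (t ^ (((s : ℝ) - 1) / k))]
  exact add_le_add
    (mul_le_of_le_one_right (abs_nonneg _) (hpow _ (by positivity)))
    (mul_le_of_le_one_right (abs_nonneg _) (hpow _ (div_nonneg (by linarith) (by positivity))))

theorem exists_abs_powerRepSum_two_sub_le (hk : 4 ≤ k) : ∃ C : ℝ, 0 ≤ C ∧ ∀ R : ℝ, 1 ≤ R →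
    |(powerRepSum k 2 ⌊R ^ k⌋₊ : ℝ) - powerRepMain k 2 (R ^ k)| ≤ C * R ^ (1 - 1 / k : ℝ) := by
  obtain ⟨C₁, hC₁, h₁⟩ := exists_abs_sum_powerRepMain_sub_le (k := k) (by omega) le_rfl (by omega)
  obtain ⟨C₂, hC₂, h₂⟩ := exists_abs_sum_sawtooth_superellipse_le hk
  refine ⟨C₁ + C₂, by positivity, ?_⟩
  intro R hR
  have hR0 : 0 < R := by linarith
  have hk0 : k ≠ 0 := by omega
  have hk0' : (k : ℝ) ≠ 0 := by exact_mod_cast hk0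
  -- This is ⌊t⌋ = t - 1/2 - `sawtooth t` at the height t of the superellipse above n.
  have hterm : ∀ n ∈ Finset.Ioc 0 ⌊R⌋₊, ((powerRepSum k 1 ⌊R ^ k - (n : ℝ) ^ k⌋₊ : ℕ) : ℝ) =
      powerRepMain k 1 (R ^ k - (n : ℝ) ^ k) - sawtooth (R * superellipse k (n / R)) := by
    intro n hn
    have hnR : (n : ℝ) ≤ R := (Nat.le_floor_iff hR0.le).1 (Finset.mem_Ioc.1 hn).2
    have hn1 : (n : ℝ) / R ≤ 1 := (div_le_one hR0).2 hnR
    have h3 : 0 ≤ 1 - ((n : ℝ) / R) ^ k := sub_nonneg.2 (pow_le_one₀ (by positivity) hn1)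
    have h4 : 0 ≤ R * superellipse k (n / R) := mul_nonneg hR0.le (Real.rpow_nonneg h3 _)
    have h5 : R ^ k - (n : ℝ) ^ k = (R * superellipse k (n / R)) ^ k := by
      rw [mul_pow, superellipse, ← Real.rpow_natCast (_ ^ _) k, ← Real.rpow_mul h3,
        one_div_mul_cancel hk0', Real.rpow_one, mul_one_sub, ← mul_pow, mul_div_cancel₀ _ hR0.ne']
    rw [h5, powerRepSum_one_floor hk0 h4, powerRepMain_one hk0 h4, sawtooth,
      natCast_floor_eq_intCast_floor h4, Int.fract]
    ring
  rw [powerRepSum_succ_floor hk0 1 hR0.le, Nat.cast_sum, Finset.sum_congr rfl hterm,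
    Finset.sum_sub_distrib]
  have e1 := abs_le.1 (h₁ R hR)
  have e2 := abs_le.1 (h₂ R hR)
  rw [Nat.cast_one] at e1
  rw [abs_le]
  constructor <;> linarith [e1.1, e1.2, e2.1, e2.2]

theorem exists_abs_powerRepSum_sub_le (hk : 4 ≤ k) {s : ℕ} (hs : 2 ≤ s) (hsk : s ≤ k + 1) :
    ∃ C : ℝ, 0 ≤ C ∧ ∀ R : ℝ, 1 ≤ R →
      |(powerRepSum k s ⌊R ^ k⌋₊ : ℝ) - powerRepMain k s (R ^ k)| ≤ C * R ^ (s - 1 - 1 / k : ℝ) := by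
  have hk0 : k ≠ 0 := by omega
  have hk4 : (4 : ℝ) ≤ k := by exact_mod_cast hk
  have hk0' : (k : ℝ) ≠ 0 := by linarith
  induction s, hs using Nat.le_induction with
  | base =>
    convert exists_abs_powerRepSum_two_sub_le hk using 7
    norm_num
  | succ s hs ih =>
    obtain ⟨C, hC, hCR⟩ := ih (by omega)
    obtain ⟨C₁, hC₁, h₁⟩ := exists_abs_sum_powerRepMain_sub_le (k := k) (s := s) (by omega)
      (by omega) (by omega)
    obtain ⟨D, hD, hDt⟩ := abs_powerRepMain_le (k := k) (s := s) (by omega)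
    refine ⟨C + D + C₁, by positivity, ?_⟩
    intro R hR
    have hR0 : 0 < R := by linarith
    have hs2 : (2 : ℝ) ≤ s := by exact_mod_cast hs
    have hexp : (0 : ℝ) ≤ s - 1 - 1 / k := by
      have : (1 / k : ℝ) ≤ 1 := by
        rw [div_le_one (by linarith)]
        linarith
      linarith
    have hone : 1 ≤ R ^ (s - 1 - 1 / k : ℝ) := Real.one_le_rpow hR hexp
    have hterm : ∀ n ∈ Finset.Ioc 0 ⌊R⌋₊, |((powerRepSum k s ⌊R ^ k - (n : ℝ) ^ k⌋₊ : ℕ) : ℝ) -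
        powerRepMain k s (R ^ k - (n : ℝ) ^ k)| ≤ (C + D) * R ^ (s - 1 - 1 / k : ℝ) := by
      intro n hn
      have hnR : (n : ℝ) ≤ R := (Nat.le_floor_iff hR0.le).1 (Finset.mem_Ioc.1 hn).2
      have ht0 : 0 ≤ R ^ k - (n : ℝ) ^ k :=
        sub_nonneg.2 (pow_le_pow_left₀ (Nat.cast_nonneg n) hnR k)
      have htR : R ^ k - (n : ℝ) ^ k ≤ R ^ k := sub_le_self _ (by positivity)
      set t := R ^ k - (n : ℝ) ^ k
      -- For t < 1 the induction hypothesis is unavailable, but the count is zero and the main terms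
      -- are bounded.
      rcases lt_or_ge t 1 with h | h
      · rw [Nat.floor_eq_zero.2 h, powerRepSum_zero_right hk0 (by omega), Nat.cast_zero, zero_sub,
          abs_neg]
        refine (hDt t ht0 h.le).trans ?_
        calc D ≤ D * R ^ (s - 1 - 1 / k : ℝ) := le_mul_of_one_le_right hD hone
          _ ≤ _ := by
            gcongr
            linarith
      · have hu1 : 1 ≤ t ^ (1 / k : ℝ) := Real.one_le_rpow h (by positivity)
        have huk : (t ^ (1 / k : ℝ)) ^ k = t := by
          rw [← Real.rpow_natCast, ← Real.rpow_mul ht0, one_div_mul_cancel hk0', Real.rpow_one]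
        have huR : t ^ (1 / k : ℝ) ≤ R := by
          rw [← pow_le_pow_iff_left₀ (by linarith) hR0.le hk0, huk]
          exact htR
        have h3 := hCR _ hu1
        rw [huk] at h3
        refine h3.trans ?_
        calc C * (t ^ (1 / k : ℝ)) ^ (s - 1 - 1 / k : ℝ) ≤ C * R ^ (s - 1 - 1 / k : ℝ) := by gcongr
          _ ≤ _ := by
            gcongr
            linarith
    have hN : (⌊R⌋₊ : ℝ) ≤ R := Nat.floor_le hR0.le
    have hsum : |∑ n ∈ Finset.Ioc 0 ⌊R⌋₊, (((powerRepSum k s ⌊R ^ k - (n : ℝ) ^ k⌋₊ : ℕ) : ℝ) -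
        powerRepMain k s (R ^ k - (n : ℝ) ^ k))| ≤ (C + D) * R ^ (s - 1 / k : ℝ) := by
      refine (Finset.abs_sum_le_sum_abs _ _).trans ((Finset.sum_le_sum hterm).trans ?_)
      rw [Finset.sum_const, Nat.card_Ioc, Nat.sub_zero, nsmul_eq_mul]
      calc _ ≤ R * ((C + D) * R ^ (s - 1 - 1 / k : ℝ)) := by gcongr
        _ = (C + D) * (R ^ (1 : ℝ) * R ^ (s - 1 - 1 / k : ℝ)) := by
          rw [Real.rpow_one]
          ring
        _ = _ := by
          rw [← Real.rpow_add hR0]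
          congr 2
          ring
    rw [powerRepSum_succ_floor hk0 s hR0.le, Nat.cast_sum,
      show ((s + 1 : ℕ) - 1 - 1 / k : ℝ) = s - 1 / k by push_cast; ring]
    rw [Finset.sum_sub_distrib] at hsum
    have e1 := abs_le.1 hsum
    have e2 := abs_le.1 (h₁ R hR)
    rw [abs_le]
    constructor <;> linarith [e1.1, e1.2, e2.1, e2.2]

end Asymptotics

theorem theorem1 (k s : ℕ) (hk : 4 ≤ k) (hs : 2 ≤ s) (hsk : s ≤ k + 1) :
    (∃ C : ℝ, ∀ n : ℕ, 1 ≤ n →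
      |(∑ m ∈ Finset.Icc 1 n, (powerRep k s m : ℝ)) - powerRepMain k s (n : ℝ)|
        ≤ C * (n : ℝ) ^ ((((s : ℝ) - 1) * k - 1) / (k : ℝ) ^ 2)) ∧
    (∃ C : ℝ, ∀ x : ℝ, 1 ≤ x →
      |(∑ m ∈ Finset.Icc 1 ⌊x⌋₊, (powerRep k s m : ℝ)) - powerRepMain k s x|
        ≤ C * x ^ ((((s : ℝ) - 1) * k - 1) / (k : ℝ) ^ 2)) := by
  have hk0 : k ≠ 0 := by omega
  have hk0' : (k : ℝ) ≠ 0 := by exact_mod_cast hk0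
  obtain ⟨C, _, hC⟩ := exists_abs_powerRepSum_sub_le hk hs hsk
  have main : ∀ x : ℝ, 1 ≤ x →
      |(∑ m ∈ Finset.Icc 1 ⌊x⌋₊, (powerRep k s m : ℝ)) - powerRepMain k s x|
        ≤ C * x ^ ((((s : ℝ) - 1) * k - 1) / (k : ℝ) ^ 2) := by
    intro x hx
    have hx0 : 0 ≤ x := by linarith
    -- With R = x^(1/k) the error exponent becomes (s - 1 - 1/k)/k = ((s - 1)k - 1)/k^2.
    have h1 := hC (x ^ (1 / k : ℝ)) (Real.one_le_rpow hx (by positivity))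
    have h2 : (x ^ (1 / k : ℝ)) ^ k = x := by
      rw [← Real.rpow_natCast, ← Real.rpow_mul hx0, one_div_mul_cancel hk0', Real.rpow_one]
    rw [h2, ← Real.rpow_mul hx0, ← sum_Icc_powerRep hk0 (by omega), Nat.cast_sum] at h1
    convert h1 using 3
    field_simp
  refine ⟨⟨C, fun n hn => ?_⟩, C, main⟩
  have := main n (by exact_mod_cast hn)
  rwa [Nat.floor_natCast] at this
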